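/- Let $M$ be a set of $k$ of the four nightrider moves $(1,2),(2,1),(1,-2),(2,-1)$, where $1\le k\le 4$, and let $\mathbf{N}^k$ be the partial nightrider with basic move set $M$: a piece at $z\in\mathbb{Z}^2$ attacks every piece at $z+rm$, for $m\in M$ and $r\in\mathbb{Z}$ (including $r=0$). For $q\ge 1$ and $n\ge 1$, let $u(q;n)$ be the number of ways to place $q$ unlabelled pieces $\mathbf{N}^k$ on the $n\times n$ board $\{1,\dots,n\}^2$ so that no two attack each other, and let $o(q;n)$ be the corresponding number for labelled pieces. Then for each $q\ge1$ the function $u(q;n)$ is a quasipolynomial in $n$, $$u(q;n)=\gamma_0(n)\,n^{2q}+\gamma_1(n)\,n^{2q-1}+\cdots+\gamma_{2q}(n),$$ whose coefficients $\gamma_i$ (which depend on $q$) are rational-valued and periodic in $n$, and $q!\,\gamma_i$ is the coefficient of $n^{2q-i}$ in the quasipolynomial $o(q;n)=q!\,u(q;n)$. Moreover, for every $i\ge0$ there are a positive integer $p_i$, independent of $q$, and polynomials $P_{i,n}\in\mathbb{Q}[x]$, depending only on $M$, $i$ and the residue class of $n$ modulo $p_i$, such that $q!\,\gamma_i(n)=P_{i,n}(q)$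 for all $n$ and all $q\ge1$ with $2q\ge i$; and every $P_{i,n}$ has the leading term $$\Big(-\frac{5k}{24}\Big)^{i}\,\frac{x^{2i}}{i!},$$ that is, $q!\,\gamma_i(n)$ is a polynomial in $q$ of degree $2i$ with leading term $\big(-\frac{5k}{24}\big)^{i}q^{2i}/i!$. -/

import Mathlib

open scoped Nat Polynomial

namespace Rider

/-- The four basic moves of the nightrider. -/
def nightriderMoves : Finset (ℤ × ℤ) := {(1, 2), (2, 1), (1, -2), (2, -1)}

/-- A rider with set `M` of basic moves attacks from `z` to `w` if `w - z` is an integral multiple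
(possibly zero or negative) of a basic move. -/
def Attacks (M : Finset (ℤ × ℤ)) (z w : ℤ × ℤ) : Prop :=
  ∃ m ∈ M, ∃ r : ℤ, w - z = r • m

/-- The integral square board `[n]²`, where `[n] = {1, …, n}`. -/
noncomputable def board (n : ℕ) : Finset (ℤ × ℤ) :=
  Finset.Icc (1 : ℤ) n ×ˢ Finset.Icc (1 : ℤ) n

open Classical in
/-- The number `u(q; n)` of nonattacking configurations of `q` unlabelled pieces with basic moves
`M` on the `n × n` board. -/
noncomputable def unlabelledCount (M : Finset (ℤ × ℤ)) (q n : ℕ) : ℕ :=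
  (((board n).powersetCard q).filter
    (fun S => ∀ z ∈ S, ∀ w ∈ S, z ≠ w → ¬ Attacks M z w)).card

open Classical in
/-- The number `o(q; n)` of nonattacking configurations of `q` labelled pieces with basic moves
`M` on the `n × n` board. -/
noncomputable def labelledCount (M : Finset (ℤ × ℤ)) (q n : ℕ) : ℕ :=
  ((Fintype.piFinset (fun _ : Fin q => board n)).filter
    (fun z => ∀ a b : Fin q, a ≠ b → ¬ Attacks M (z a) (z b))).card

/-- `f` is a quasipolynomial function on the positive integers, of degree at most `d`, and `c i` is
the (periodic) coefficient of `n ^ (d - i)` in it, for `0 ≤ i ≤ d`. (The coefficients `c i`,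
`i ≤ d`, are determined by `f` and `d`.) -/
def IsQuasipolynomial (f : ℕ → ℕ) (d : ℕ) (c : ℕ → ℕ → ℚ) : Prop :=
  (∃ p : ℕ, 0 < p ∧ ∀ i ≤ d, Function.Periodic (c i) p) ∧
    ∀ n : ℕ, 1 ≤ n → (f n : ℚ) = ∑ i ∈ Finset.range (d + 1), c i n * (n : ℚ) ^ (d - i)

end Rider

/-! Write o(j) for the labelled count on the n × n board. Its quasipolynomiality is obtained without
Ehrhart theory. The count is a sum, over q board positions, of a product of indicators that certain
linear forms are nonzero. Functions built from linear forms, periodic functions of forms and signs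
of forms are an algebra stable under summing one variable over 0 < y ≤ ν(x) (`sum_Ioc_mem`). After
all coordinates are summed, a function of n alone remains. The forms have no constant term, so their
signs are constant for n > 0 and the result is a quasipolynomial at every n ≥ 1.

The dependence on q comes from the binomial transform F_κ = Σ_j C(κ,j) (-n²)^(κ-j) o(j). It equals
the sum, over all placements z of κ pieces, of the signed number of independent sets of the attack
graph of z (`sum_choose_independentCount`). That number vanishes as soon as some piece attacks no
other (`signedIndependent_eq_zero`). In the remaining placements every component has at least two
vertices. A graph with c components admits O(n^(κ+c)) placements, since each component has one free
piece (n² choices) and every other piece lies on one of O(n) squares. Hence deg F_κ ≤ κ + ⌊κ/2⌋.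

Inversion gives o(q) = Σ_κ C(q,κ) n^(2(q-κ)) F_κ. So the coefficient of n^(2q-i) is Σ_κ C(q,κ)
[n^(2κ-i)] F_κ, and the degree bound kills all κ > 2i. This is a polynomial in q of degree at most
2i. Its top term comes from κ = 2i and the coefficient of n^(3i) in F_(2i), to which only perfect
matchings contribute. There are (2i)!/(2^i i!) of them, each with sign (-1)^i and about (5k n³/12)^i
placements, as 5k n³/12 is asymptotically the number of attacking ordered pairs. Dividing by (2i)!
gives the stated leading coefficient. -/

namespace Rider

/-! ### Quasipolynomials of one integer variable. -/

/-- `f` is a quasipolynomial function on the integers. -/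
def IsQuasiPoly (f : ℤ → ℚ) : Prop :=
  ∃ d : ℕ, 0 < d ∧ ∃ Q : ℤ → ℚ[X], Function.Periodic Q (d : ℤ) ∧ ∀ n, f n = (Q n).eval (n : ℚ)

namespace IsQuasiPoly

theorem of_periodic {h : ℤ → ℚ} {d : ℕ} (hd : 0 < d) (hh : Function.Periodic h (d : ℤ)) :
    IsQuasiPoly h :=
  ⟨d, hd, fun n => Polynomial.C (h n), fun n => by simp [hh n], fun n => by simp⟩

theorem eval (Q : ℚ[X]) : IsQuasiPoly fun n => Q.eval (n : ℚ) :=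
  ⟨1, one_pos, fun _ => Q, fun _ => rfl, fun _ => rfl⟩

theorem const (c : ℚ) : IsQuasiPoly fun _ => c := by simpa using eval (Polynomial.C c)

theorem add {f g : ℤ → ℚ} (hf : IsQuasiPoly f) (hg : IsQuasiPoly g) :
    IsQuasiPoly fun n => f n + g n := by
  obtain ⟨d, hd, Q, hQ, hfQ⟩ := hf
  obtain ⟨e, he, R, hR, hgR⟩ := hg
  refine ⟨d * e, by positivity, fun n => Q n + R n, ?_, fun n => by simp [hfQ, hgR]⟩
  have h1 := hQ.int_mul e
  have h2 := hR.int_mul d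
  intro n
  have h3 := h1 n
  have h4 := h2 n
  simp only [Int.cast_natCast] at h3 h4
  push_cast
  rw [h4, mul_comm (d : ℤ) e, h3]

theorem mul {f g : ℤ → ℚ} (hf : IsQuasiPoly f) (hg : IsQuasiPoly g) :
    IsQuasiPoly fun n => f n * g n := by
  obtain ⟨d, hd, Q, hQ, hfQ⟩ := hf
  obtain ⟨e, he, R, hR, hgR⟩ := hg
  refine ⟨d * e, by positivity, fun n => Q n * R n, ?_, fun n => by simp [hfQ, hgR]⟩
  have h1 := hQ.int_mul e
  have h2 := hR.int_mul d
  intro n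
  have h3 := h1 n
  have h4 := h2 n
  simp only [Int.cast_natCast] at h3 h4
  push_cast
  rw [h4, mul_comm (d : ℤ) e, h3]

theorem sum {α : Type*} {s : Finset α} {f : α → ℤ → ℚ} (hf : ∀ a ∈ s, IsQuasiPoly (f a)) :
    IsQuasiPoly fun n => ∑ a ∈ s, f a n := by
  classical
  induction s using Finset.induction_on with
  | empty => simpa using const 0
  | insert a s ha ih =>
    simp only [Finset.sum_insert ha]
    exact (hf a (by simp)).add (ih fun b hb => hf b (by simp [hb]))

theorem comp_sub {f : ℤ → ℚ} (hf : IsQuasiPoly f) (j : ℤ) : IsQuasiPoly fun n => f (n - j) := by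
  obtain ⟨d, hd, Q, hQ, hfQ⟩ := hf
  refine ⟨d, hd, fun n => (Q (n - j)).comp (Polynomial.X - Polynomial.C (j : ℚ)), fun n => ?_,
    fun n => by simp [hfQ]⟩
  have : n + d - j = n - j + d := by ring
  simp only [this, hQ (n - j)]

theorem comp_ediv {f : ℤ → ℚ} (hf : IsQuasiPoly f) {b : ℤ} (hb : 0 < b) :
    IsQuasiPoly fun n => f (n / b) := by
  obtain ⟨d, hd, Q, hQ, hfQ⟩ := hf
  lift b to ℕ using hb.le
  have hb0 : (b : ℤ) ≠ 0 := hb.ne'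
  have hbpos : 0 < b := by exact_mod_cast hb
  refine ⟨b * d, by positivity, fun n => (Q (n / b)).comp
    (Polynomial.C (1 / (b : ℚ)) * (Polynomial.X - Polynomial.C ((n % b : ℤ) : ℚ))), fun n => ?_,
    fun n => ?_⟩
  · have h1 : (n + ((b * d : ℕ) : ℤ)) / b = n / b + d := by
      push_cast
      rw [Int.add_mul_ediv_left _ _ hb0]
    have h2 : (n + ((b * d : ℕ) : ℤ)) % b = n % b := by
      push_cast
      rw [Int.add_mul_emod_self_left]
    simp only [h1, h2, hQ (n / b)]
  · have h : ((n / b : ℤ) : ℚ) = 1 / (b : ℚ) * ((n : ℚ) - ((n % b : ℤ) : ℚ)) := by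
      have hbq : (b : ℚ) ≠ 0 := by exact_mod_cast hb0
      have : (n : ℚ) = b * ((n / b : ℤ) : ℚ) + ((n % b : ℤ) : ℚ) := by
        exact_mod_cast (Int.mul_ediv_add_emod n b).symm
      field_simp
      linarith
    simp [hfQ, h]

theorem exists_step_antidifference (Q : ℚ[X]) {d : ℕ} (hd : 0 < d) :
    ∃ R : ℚ[X], ∀ x : ℚ, R.eval x - R.eval (x - d) = Q.eval x := by
  have hdq : (d : ℚ) ≠ 0 := by positivity
  induction Q using Polynomial.induction_on' with
  | add p q hp hq =>
    obtain ⟨R, hR⟩ := hp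
    obtain ⟨S, hS⟩ := hq
    exact ⟨R + S, fun x => by simp only [Polynomial.eval_add, ← hR, ← hS]; ring⟩
  | monomial j a =>
    -- The identity B_{j+1}(1+t) - B_{j+1}(t) = (j+1) t^j, taken at t = x/d.
    refine ⟨Polynomial.C (a * d ^ j / (j + 1)) * (Polynomial.bernoulli (j + 1)).comp
      (1 + Polynomial.C (1 / (d : ℚ)) * Polynomial.X), fun x => ?_⟩
    have h := Polynomial.bernoulli_eval_one_add (j + 1) (x / d)
    have e : 1 + 1 / (d : ℚ) * (x - d) = x / d := by field_simp; ring
    have e' : 1 + 1 / (d : ℚ) * x = 1 + x / d := by ring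
    simp only [Polynomial.eval_mul, Polynomial.eval_C, Polynomial.eval_comp, Polynomial.eval_add,
      Polynomial.eval_one, Polynomial.eval_X, Polynomial.eval_monomial, e, e', h]
    have : (j : ℚ) + 1 ≠ 0 := by positivity
    simp only [Nat.add_sub_cancel]
    push_cast
    rw [div_pow]
    field_simp
    ring

/-- Within a residue class mod d, `f` is a polynomial and has a step-d antidifference; these glue to
`H` with H(n) - H(n-d) = f(n). The sum of d consecutive values of `H` then telescopes to a step-1
antidifference. -/
theorem exists_antidifference {f : ℤ → ℚ} (hf : IsQuasiPoly f) :
    ∃ G : ℤ → ℚ, IsQuasiPoly G ∧ ∀ n, G n - G (n - 1) = f n := by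
  obtain ⟨d, hd, Q, hQ, hfQ⟩ := hf
  choose R hR using fun n => exists_step_antidifference (Q n) hd
  have hper : Function.Periodic (fun n : ℤ => R (n % d)) (d : ℤ) := fun n => by simp
  have hQmod : ∀ n : ℤ, Q (n % d) = Q n := fun n => by
    have := (hQ.int_mul (n / d)) (n % d)
    simp only [Int.cast_id] at this
    rw [← this, mul_comm, Int.emod_add_mul_ediv]
  let H : ℤ → ℚ := fun n => (R (n % d)).eval (n : ℚ)
  have hH : IsQuasiPoly H := ⟨d, hd, _, hper, fun _ => rfl⟩
  refine ⟨fun n => ∑ j ∈ Finset.range d, H (n - (j : ℕ)), sum fun j _ => hH.comp_sub j,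
    fun n => ?_⟩
  rw [← Finset.sum_sub_distrib]
  have h : ∀ j ∈ Finset.range d, H (n - (j : ℕ)) - H (n - 1 - (j : ℕ)) =
      (fun j : ℕ => H (n - j)) j - (fun j : ℕ => H (n - j)) (j + 1) := fun j _ => by
    simp only [Nat.cast_add, Nat.cast_one]
    congr 2
    ring
  rw [Finset.sum_congr rfl h, Finset.sum_range_sub']
  have h2 : (n - (d : ℕ)) % d = n % d := by simp
  simp only [H, h2, Nat.cast_zero, sub_zero]
  push_cast
  rw [hR, hQmod, hfQ]

end IsQuasiPoly

theorem sum_Ioc_eq_sub {f G : ℤ → ℚ} (h : ∀ n, G n - G (n - 1) = f n) {a b : ℤ} (hab : a ≤ b) :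
    ∑ y ∈ Finset.Ioc a b, f y = G b - G a := by
  induction b, hab using Int.leInduction with
  | base => simp
  | succ b hab ih =>
    have : Finset.Ioc a (b + 1) = insert (b + 1) (Finset.Ioc a b) := by
      ext y
      simp only [Finset.mem_Ioc, Finset.mem_insert]
      omega
    rw [this, Finset.sum_insert (by simp), ih, ← h (b + 1)]
    simp

/-! ### The algebra of piecewise quasipolynomials and its stability under summation. -/

section Piecewise

variable {V W : Type*} [AddCommGroup V] [AddCommGroup W]

/-- The algebra of functions that are quasipolynomial on each cell of some arrangement of
homogeneous hyperplanes. -/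
def piecewiseQuasiPoly (V : Type*) [AddCommGroup V] : Subalgebra ℚ (V → ℚ) :=
  Algebra.adjoin ℚ
    ({f | ∃ ℓ : V →+ ℤ, f = fun x => (ℓ x : ℚ)} ∪
      ({f | ∃ ℓ : V →+ ℤ, ∃ d : ℕ, 0 < d ∧ ∃ h : ℤ → ℚ, Function.Periodic h (d : ℤ) ∧
        f = fun x => h (ℓ x)} ∪
      {f | ∃ ℓ : V →+ ℤ, f = fun x => if 0 < ℓ x then 1 else 0}))

theorem form_mem (ℓ : V →+ ℤ) : (fun x => (ℓ x : ℚ)) ∈ piecewiseQuasiPoly V :=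
  Algebra.subset_adjoin (Or.inl ⟨ℓ, rfl⟩)

theorem periodic_mem (ℓ : V →+ ℤ) {d : ℕ} (hd : 0 < d) {h : ℤ → ℚ}
    (hh : Function.Periodic h (d : ℤ)) : (fun x => h (ℓ x)) ∈ piecewiseQuasiPoly V :=
  Algebra.subset_adjoin (Or.inr (Or.inl ⟨ℓ, d, hd, h, hh, rfl⟩))

theorem ite_pos_mem (ℓ : V →+ ℤ) :
    (fun x => if 0 < ℓ x then (1 : ℚ) else 0) ∈ piecewiseQuasiPoly V :=
  Algebra.subset_adjoin (Or.inr (Or.inr ⟨ℓ, rfl⟩))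

theorem const_mem (c : ℚ) : (fun _ => c) ∈ piecewiseQuasiPoly V :=
  (piecewiseQuasiPoly V).algebraMap_mem c

theorem ite_lt_mem (ℓ ψ : V →+ ℤ) :
    (fun x => if ℓ x < ψ x then (1 : ℚ) else 0) ∈ piecewiseQuasiPoly V := by
  simpa using ite_pos_mem (ψ - ℓ)

theorem ite_le_mem (ℓ ψ : V →+ ℤ) :
    (fun x => if ℓ x ≤ ψ x then (1 : ℚ) else 0) ∈ piecewiseQuasiPoly V := by
  convert sub_mem (const_mem 1) (ite_lt_mem ψ ℓ) using 1
  funext x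
  by_cases h : ℓ x ≤ ψ x
  · simp [h, not_lt.2 h]
  · simp [h, not_le.1 h]

theorem ite_eq_zero_mem (ℓ : V →+ ℤ) :
    (fun x => if ℓ x = 0 then (1 : ℚ) else 0) ∈ piecewiseQuasiPoly V := by
  convert mul_mem (ite_le_mem ℓ 0) (ite_le_mem 0 ℓ) using 1
  funext x
  simp only [Pi.mul_apply, AddMonoidHom.zero_apply]
  split_ifs <;> first | omega | simp

theorem comp_mem (ψ : W →+ V) {f : V → ℚ} (hf : f ∈ piecewiseQuasiPoly V) :
    (fun x => f (ψ x)) ∈ piecewiseQuasiPoly W := by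
  induction hf using Algebra.adjoin_induction with
  | mem f hf =>
    rcases hf with ⟨ℓ, rfl⟩ | ⟨ℓ, d, hd, h, hh, rfl⟩ | ⟨ℓ, rfl⟩
    · exact form_mem (ℓ.comp ψ)
    · exact periodic_mem (ℓ.comp ψ) hd hh
    · exact ite_pos_mem (ℓ.comp ψ)
  | algebraMap r => exact const_mem r
  | add f g _ _ hf hg => exact add_mem hf hg
  | mul f g _ _ hf hg => exact mul_mem hf hg

theorem eval_form_mem (ℓ : V →+ ℤ) (Q : ℚ[X]) :
    (fun x => Q.eval (ℓ x : ℚ)) ∈ piecewiseQuasiPoly V := by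
  induction Q using Polynomial.induction_on' with
  | add p q hp hq =>
    convert add_mem hp hq using 1
    funext x
    simp
  | monomial j a =>
    convert mul_mem (const_mem a) (pow_mem (form_mem ℓ) j) using 1
    funext x
    simp

theorem IsQuasiPoly.comp_form_mem {f : ℤ → ℚ} (hf : IsQuasiPoly f) (ℓ : V →+ ℤ) :
    (fun x => f (ℓ x)) ∈ piecewiseQuasiPoly V := by
  obtain ⟨d, hd, Q, hQ, hfQ⟩ := hf
  have hQmod : ∀ n : ℤ, Q (n % d) = Q n := fun n => by
    have := (hQ.int_mul (n / d)) (n % d)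
    simp only [Int.cast_id] at this
    rw [← this, mul_comm, Int.emod_add_mul_ediv]
  have : (fun x => f (ℓ x)) = ∑ c ∈ Finset.range d,
      (fun x => (if ℓ x % d = c then (1 : ℚ) else 0)) * fun x => (Q c).eval (ℓ x : ℚ) := by
    funext x
    have hdz : (d : ℤ) ≠ 0 := by omega
    have h0 := Int.emod_nonneg (ℓ x) hdz
    have h1 := Int.emod_lt_of_pos (ℓ x) (by omega : (0 : ℤ) < d)
    rw [Finset.sum_apply, Finset.sum_eq_single (ℓ x % d).toNat]
    · simp [h0, hQmod, hfQ]
    · intro c _ hc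
      have : ¬ ℓ x % d = c := by omega
      simp [this]
    · intro h
      simp at h
      omega
  rw [this]
  refine sum_mem fun c _ => mul_mem ?_ (eval_form_mem ℓ _)
  exact periodic_mem ℓ hd (h := fun n => if n % d = c then (1 : ℚ) else 0) fun n => by simp

/-- The functions `⌊ℓ x / b⌋` and `⌈ℓ x / b⌉ - 1`, with `ℓ` a linear form and `b > 0`. -/
def thresholds (V : Type*) [AddCommGroup V] : Set (V → ℤ) :=
  {θ | ∃ ℓ : V →+ ℤ, ∃ b : ℤ, 0 < b ∧ ∃ ε : ℤ, (ε = 0 ∨ ε = 1) ∧ θ = fun x => (ℓ x - ε) / b}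

theorem form_mem_thresholds (ℓ : V →+ ℤ) : (fun x => ℓ x) ∈ thresholds V :=
  ⟨ℓ, 1, one_pos, 0, Or.inl rfl, by simp⟩

theorem IsQuasiPoly.comp_threshold_mem {f : ℤ → ℚ} (hf : IsQuasiPoly f) {θ : V → ℤ}
    (hθ : θ ∈ thresholds V) : (fun x => f (θ x)) ∈ piecewiseQuasiPoly V := by
  obtain ⟨ℓ, b, hb, ε, -, rfl⟩ := hθ
  exact ((hf.comp_ediv hb).comp_sub ε).comp_form_mem ℓ

theorem ediv_le_ediv_of_cross {u v b c ε δ : ℤ} (hb : 0 < b) (hc : 0 < c)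
    (h : c * u - ε * c < b * v + (1 - δ) * b) : (u - ε) / b ≤ (v - δ) / c := by
  rw [Int.le_ediv_iff_mul_le hc]
  by_contra hlt
  have h1 := Int.ediv_mul_le (u - ε) hb.ne'
  set t := (u - ε) / b
  have h2 : v - δ + 1 ≤ t * c := by omega
  nlinarith [mul_le_mul_of_nonneg_left h1 hc.le, mul_le_mul_of_nonneg_left h2 hb.le]

/-- Two rounded quotients are compared by cross-multiplying the unrounded ones, which keeps the
forms homogeneous. The offsets ε, δ only decide whether that comparison is strict. The two
alternatives overlap at ties, where either answer serves. -/
theorem exists_comparator {θ η : V → ℤ} (hθ : θ ∈ thresholds V) (hη : η ∈ thresholds V) :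
    ∃ g ∈ piecewiseQuasiPoly V, ∀ x, (g x = 1 ∧ θ x ≤ η x) ∨ (g x = 0 ∧ η x ≤ θ x) := by
  obtain ⟨ℓ, b, hb, ε, hε, rfl⟩ := hθ
  obtain ⟨ψ, c, hc, δ, hδ, rfl⟩ := hη
  by_cases hcase : ε = 1 ∨ δ = 0
  · refine ⟨_, ite_le_mem (c • ℓ) (b • ψ), fun x => ?_⟩
    simp only [AddMonoidHom.coe_smul, Pi.smul_apply, smul_eq_mul]
    by_cases h : c * ℓ x ≤ b * ψ x
    · refine Or.inl ⟨by simp [h], ediv_le_ediv_of_cross hb hc ?_⟩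
      rcases hε with rfl | rfl <;> rcases hδ with rfl | rfl <;> simp at hcase <;> linarith
    · refine Or.inr ⟨by simp [h], ediv_le_ediv_of_cross hc hb ?_⟩
      rcases hε with rfl | rfl <;> rcases hδ with rfl | rfl <;> simp at hcase <;> linarith
  · refine ⟨_, ite_lt_mem (c • ℓ) (b • ψ), fun x => ?_⟩
    simp only [AddMonoidHom.coe_smul, Pi.smul_apply, smul_eq_mul]
    by_cases h : c * ℓ x < b * ψ x
    · refine Or.inl ⟨by simp [h], ediv_le_ediv_of_cross hb hc ?_⟩
      rcases hε with rfl | rfl <;> rcases hδ with rfl | rfl <;> simp at hcase; linarith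
    · refine Or.inr ⟨by simp [h], ediv_le_ediv_of_cross hc hb ?_⟩
      rcases hε with rfl | rfl <;> rcases hδ with rfl | rfl <;> simp at hcase; linarith

/-- Products `g x * P y * [θ x < y]` separating the last variable up to a threshold. -/
def thresholdTerms (V : Type*) [AddCommGroup V] : Set (V × ℤ → ℚ) :=
  {f | ∃ g ∈ piecewiseQuasiPoly V, ∃ P, IsQuasiPoly P ∧ ∃ θ ∈ thresholds V,
    f = fun p => g p.1 * P p.2 * if θ p.1 < p.2 then 1 else 0}

/-- A product of two steps [θ₁ < y][θ₂ < y] is the step at the larger threshold, and the comparator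
selects which one that is. -/
theorem mul_mem_span_thresholdTerms {f g : V × ℤ → ℚ}
    (hf : f ∈ Submodule.span ℚ (thresholdTerms V)) (hg : g ∈ Submodule.span ℚ (thresholdTerms V)) :
    f * g ∈ Submodule.span ℚ (thresholdTerms V) := by
  have h := Submodule.mul_mem_mul hf hg
  rw [Submodule.span_mul_span] at h
  refine Submodule.span_le.2 ?_ h
  rintro _ ⟨_, ⟨g₁, hg₁, P₁, hP₁, θ₁, hθ₁, rfl⟩, _, ⟨g₂, hg₂, P₂, hP₂, θ₂, hθ₂, rfl⟩, rfl⟩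
  obtain ⟨c, hc, hcmp⟩ := exists_comparator hθ₁ hθ₂
  have h1 := Submodule.subset_span (R := ℚ) (s := thresholdTerms V)
    ⟨_, mul_mem (mul_mem hg₁ hg₂) hc, _, hP₁.mul hP₂, θ₂, hθ₂, rfl⟩
  have h2 := Submodule.subset_span (R := ℚ) (s := thresholdTerms V)
    ⟨_, mul_mem (mul_mem hg₁ hg₂) (sub_mem (const_mem 1) hc), _, hP₁.mul hP₂, θ₁, hθ₁, rfl⟩
  rw [SetLike.mem_coe]
  convert add_mem h1 h2 using 1
  funext p
  simp only [Pi.mul_apply, Pi.add_apply, Pi.sub_apply]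
  rcases hcmp p.1 with ⟨hc1, hle⟩ | ⟨hc0, hle⟩
  · rw [hc1]
    split_ifs <;> first | omega | ring
  · rw [hc0]
    split_ifs <;> first | omega | ring

/-- The factor [0 < y] supplies the lower threshold that a generator may lack. Each generator is
split as ψ(x) + b y: linear forms separate directly, periodic functions after fixing ψ(x) mod d, and
signs become a step in y according to the sign of b. -/
theorem mul_pos_mem_span_thresholdTerms {f : V × ℤ → ℚ} (hf : f ∈ piecewiseQuasiPoly (V × ℤ)) :
    (f * fun p => if 0 < p.2 then 1 else 0) ∈ Submodule.span ℚ (thresholdTerms V) := by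
  have hsub := Submodule.subset_span (R := ℚ) (s := thresholdTerms V)
  have h0 : (fun _ : V => (0 : ℤ)) ∈ thresholds V := form_mem_thresholds 0
  have hsplit : ∀ (ℓ : V × ℤ →+ ℤ) (p : V × ℤ),
      ℓ p = ℓ.comp (AddMonoidHom.inl V ℤ) p.1 + ℓ (0, 1) * p.2 := fun ℓ p => by
    have : p = (p.1, 0) + p.2 • ((0, 1) : V × ℤ) := by ext <;> simp
    conv_lhs => rw [this, map_add, map_zsmul]
    simp [mul_comm]
  have hone : (fun p : V × ℤ => if 0 < p.2 then (1 : ℚ) else 0) ∈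
      Submodule.span ℚ (thresholdTerms V) := by
    refine hsub ⟨_, const_mem 1, _, IsQuasiPoly.const 1, _, h0, ?_⟩
    funext p
    simp
  induction hf using Algebra.adjoin_induction with
  | mem f hf =>
    rcases hf with ⟨ℓ, rfl⟩ | ⟨ℓ, d, hd, h, hh, rfl⟩ | ⟨ℓ, rfl⟩
    · have h1 := hsub ⟨_, form_mem (ℓ.comp (AddMonoidHom.inl V ℤ)), _, IsQuasiPoly.const 1, _, h0,
        rfl⟩
      have h2 := hsub ⟨_, const_mem (ℓ (0, 1)), _, IsQuasiPoly.eval Polynomial.X, _, h0, rfl⟩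
      convert add_mem h1 h2 using 1
      funext p
      simp only [Pi.mul_apply, Pi.add_apply, hsplit ℓ p]
      push_cast
      simp only [Polynomial.eval_X]
      ring
    · set ψ := ℓ.comp (AddMonoidHom.inl V ℤ) with hψ
      have hmod : ∀ n : ℤ, ∀ m : ℤ, h (n % d + m) = h (n + m) := fun n m => by
        have := (hh.int_mul (n / d)) (n % d + m)
        simp only [Int.cast_id] at this
        rw [← this]
        congr 1
        linarith [Int.emod_add_mul_ediv n d, mul_comm (n / d) (d : ℤ)]
      have hterm : ∀ c : ℕ, (fun p : V × ℤ => (if ψ p.1 % d = c then (1 : ℚ) else 0) *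
          h (c + ℓ (0, 1) * p.2) * if 0 < p.2 then 1 else 0) ∈
          Submodule.span ℚ (thresholdTerms V) := fun c => by
        refine hsub ⟨_, periodic_mem ψ hd (h := fun n => if n % d = c then (1 : ℚ) else 0)
          fun n => by simp, fun y => h (c + ℓ (0, 1) * y), ?_, _, h0, rfl⟩
        refine IsQuasiPoly.of_periodic hd fun n => ?_
        have := (hh.int_mul (ℓ (0, 1))) (c + ℓ (0, 1) * n)
        simp only [Int.cast_id] at this
        rw [← this]
        congr 1
        ring
      convert sum_mem fun c (_ : c ∈ Finset.range d) => hterm c using 1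
      funext p
      have hdz : (d : ℤ) ≠ 0 := by omega
      have e0 := Int.emod_nonneg (ψ p.1) hdz
      have e1 := Int.emod_lt_of_pos (ψ p.1) (by omega : (0 : ℤ) < d)
      rw [Finset.sum_apply, Finset.sum_eq_single (ψ p.1 % d).toNat]
      · simp only [Pi.mul_apply, hsplit ℓ p, ← hψ]
        simp only [Int.toNat_of_nonneg e0, if_true, hmod, one_mul]
      · intro c _ hc
        have : ¬ ψ p.1 % d = c := by omega
        simp [this]
      · intro h
        simp at h
        omega
    · set ψ := ℓ.comp (AddMonoidHom.inl V ℤ) with hψ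
      rcases lt_trichotomy (ℓ (0, 1)) 0 with hb | hb | hb
      · have hb' : 0 < -ℓ (0, 1) := by omega
        have h1 := hsub ⟨_, const_mem (1 : ℚ), _, IsQuasiPoly.const 1, _,
          ⟨ψ, _, hb', 1, Or.inr rfl, rfl⟩, rfl⟩
        -- For b < 0, ψ + b y > 0 means y ≤ ⌊(ψ - 1)/(-b)⌋, the complement of a step; this is what
        -- the thresholds with ε = 1 are for.
        convert sub_mem hone (mul_mem_span_thresholdTerms h1 hone) using 1
        funext p
        simp only [Pi.mul_apply, Pi.sub_apply, hsplit ℓ p, Int.ediv_lt_iff_lt_mul hb', ← hψ]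
        split_ifs <;> first | (exfalso; linarith) | simp
      · have h1 := hsub ⟨_, ite_pos_mem ψ, _, IsQuasiPoly.const 1, _, h0, rfl⟩
        rw [SetLike.mem_coe] at h1
        convert h1 using 1
        funext p
        simp only [Pi.mul_apply, hsplit ℓ p, hb, ← hψ]
        simp
      · have h1 := hsub ⟨_, const_mem (1 : ℚ), _, IsQuasiPoly.const 1, _,
          ⟨-ψ, _, hb, 0, Or.inl rfl, rfl⟩, rfl⟩
        convert mul_mem_span_thresholdTerms h1 hone using 1
        funext p
        simp only [Pi.mul_apply, hsplit ℓ p, Int.ediv_lt_iff_lt_mul hb, ← hψ,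
          AddMonoidHom.neg_apply]
        split_ifs <;> first | (exfalso; linarith) | simp
  | algebraMap r =>
    have := Submodule.smul_mem _ r hone
    convert this using 1
    funext p
    simp [Algebra.algebraMap_eq_smul_one]
  | add f g _ _ hf hg => rw [add_mul]; exact add_mem hf hg
  | mul f g _ _ hf hg =>
    convert mul_mem_span_thresholdTerms hf hg using 1
    funext p
    simp only [Pi.mul_apply]
    split_ifs <;> ring

/-- On a threshold term the sum runs over max(θ, 0) < y ≤ ν of a one-variable quasipolynomial, so it
is a difference of antidifferences evaluated at thresholds. Comparators choose the maximum and
detect an empty range. -/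
theorem sum_Ioc_mem (ν : V →+ ℤ) {f : V × ℤ → ℚ} (hf : f ∈ piecewiseQuasiPoly (V × ℤ)) :
    (fun x => ∑ y ∈ Finset.Ioc 0 (ν x), f (x, y)) ∈ piecewiseQuasiPoly V := by
  have key : ∀ F ∈ Submodule.span ℚ (thresholdTerms V),
      (fun x => ∑ y ∈ Finset.Ioc 0 (ν x), F (x, y)) ∈ piecewiseQuasiPoly V := by
    intro F hF
    induction hF using Submodule.span_induction with
    | mem F hF =>
      obtain ⟨g, hg, P, hP, θ, hθ, rfl⟩ := hF
      obtain ⟨G, hG, hGP⟩ := hP.exists_antidifference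
      have h0 : (fun _ : V => (0 : ℤ)) ∈ thresholds V := form_mem_thresholds 0
      have hν := form_mem_thresholds ν
      have hIoc : ∀ η ∈ thresholds V,
          (fun x => ∑ y ∈ Finset.Ioc (η x) (ν x), P y) ∈ piecewiseQuasiPoly V := by
        intro η hη
        obtain ⟨c, hc, hcmp⟩ := exists_comparator hη hν
        convert mul_mem hc (sub_mem (hG.comp_threshold_mem hν) (hG.comp_threshold_mem hη)) using 1
        funext x
        rcases hcmp x with ⟨h1, hle⟩ | ⟨h1, hle⟩
        · simp [sum_Ioc_eq_sub hGP hle, h1]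
        · simp [h1, Finset.Ioc_eq_empty_of_le hle]
      obtain ⟨c, hc, hcmp⟩ := exists_comparator hθ h0
      convert mul_mem hg (add_mem (mul_mem hc (hIoc _ h0))
        (mul_mem (sub_mem (const_mem 1) hc) (hIoc _ hθ))) using 1
      funext x
      simp only [Pi.mul_apply, Pi.add_apply, Pi.sub_apply, mul_assoc]
      rw [← Finset.mul_sum]
      congr 1
      simp only [mul_ite, mul_one, mul_zero]
      rw [← Finset.sum_filter]
      rcases hcmp x with ⟨h1, hle⟩ | ⟨h1, hle⟩
      · rw [h1, one_mul, sub_self, zero_mul, add_zero]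
        congr 1
        ext y
        simp only [Finset.mem_filter, Finset.mem_Ioc]
        omega
      · rw [h1, zero_mul, sub_zero, one_mul, zero_add]
        congr 1
        ext y
        simp only [Finset.mem_filter, Finset.mem_Ioc]
        omega
    | zero => simpa using const_mem (V := V) 0
    | add F G _ _ hF hG =>
      convert add_mem hF hG using 1
      funext x
      simp [Finset.sum_add_distrib]
    | smul r F _ hF =>
      convert Subalgebra.smul_mem _ hF r using 1
      funext x
      simp [Finset.mul_sum]
  convert key _ (mul_pos_mem_span_thresholdTerms hf) using 1
  funext x
  refine Finset.sum_congr rfl fun y hy => ?_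
  simp [(Finset.mem_Ioc.1 hy).1]

/-- A form on ℤ is n ↦ n ℓ(1), of constant sign on n > 0, so no piecewise behaviour is left there.
-/
theorem exists_isQuasiPoly_of_mem {f : ℤ → ℚ} (hf : f ∈ piecewiseQuasiPoly ℤ) :
    ∃ g, IsQuasiPoly g ∧ ∀ n, 0 < n → f n = g n := by
  have hlin : ∀ (ℓ : ℤ →+ ℤ) n, ℓ n = n * ℓ 1 := fun ℓ n => by
    conv_lhs => rw [← mul_one n, ← smul_eq_mul, map_zsmul, smul_eq_mul]
  induction hf using Algebra.adjoin_induction with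
  | mem f hf =>
    rcases hf with ⟨ℓ, rfl⟩ | ⟨ℓ, d, hd, h, hh, rfl⟩ | ⟨ℓ, rfl⟩
    · refine ⟨_, IsQuasiPoly.eval (Polynomial.X * Polynomial.C (ℓ 1 : ℚ)), fun n _ => ?_⟩
      simp only [hlin ℓ n]
      simp
    · refine ⟨_, IsQuasiPoly.of_periodic hd (h := fun n => h (ℓ n)) fun n => ?_, fun n _ => rfl⟩
      have := (hh.int_mul (ℓ 1)) (ℓ n)
      simp only [Int.cast_id] at this
      simp only [map_add]
      rw [← this, hlin ℓ d, mul_comm]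
    · refine ⟨_, IsQuasiPoly.const (if 0 < ℓ 1 then 1 else 0), fun n hn => ?_⟩
      simp only [hlin ℓ n]
      simp [hn]
  | algebraMap r => exact ⟨_, IsQuasiPoly.const r, fun _ _ => rfl⟩
  | add f g _ _ hf hg =>
    obtain ⟨f', hf', h1⟩ := hf
    obtain ⟨g', hg', h2⟩ := hg
    exact ⟨_, hf'.add hg', fun n hn => by simp [h1 n hn, h2 n hn]⟩
  | mul f g _ _ hf hg =>
    obtain ⟨f', hf', h1⟩ := hf
    obtain ⟨g', hg', h2⟩ := hg
    exact ⟨_, hf'.mul hg', fun n hn => by simp [h1 n hn, h2 n hn]⟩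

end Piecewise

/-! ### Summation over placements, and quasipolynomiality of the labelled count. -/

section Sums

variable {V : Type*} [AddCommGroup V]

theorem sum_piFinset_succ {α : Type*} [DecidableEq α] (m : ℕ) (S : Finset α)
    (F : (Fin (m + 1) → α) → ℚ) :
    ∑ z ∈ Fintype.piFinset fun _ => S, F z =
      ∑ y ∈ S, ∑ z ∈ Fintype.piFinset fun _ : Fin m => S, F (Fin.cons y z) := by
  rw [← Finset.sum_product']
  refine Finset.sum_nbij' (fun z => (z 0, Fin.tail z)) (fun p => Fin.cons p.1 p.2) ?_ ?_ ?_ ?_ ?_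
  · intro z hz
    simp only [Fintype.mem_piFinset] at hz
    simp [Fin.tail, hz]
  · intro p hp
    simp only [Finset.mem_product, Fintype.mem_piFinset] at hp
    simp only [Fintype.mem_piFinset]
    intro a
    refine Fin.cases ?_ (fun b => ?_) a
    · simpa using hp.1
    · simpa using hp.2 b
  · intro z _
    simp
  · intro p _
    simp
  · intro z _
    simp

theorem sum_piFinset_mem (m : ℕ) (ν : V →+ ℤ) {f : V × (Fin m → ℤ × ℤ) → ℚ}
    (hf : f ∈ piecewiseQuasiPoly (V × (Fin m → ℤ × ℤ))) :
    (fun x => ∑ z ∈ Fintype.piFinset fun _ : Fin m => Finset.Ioc 0 (ν x) ×ˢ Finset.Ioc 0 (ν x),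
      f (x, z)) ∈ piecewiseQuasiPoly V := by
  induction m generalizing V with
  | zero =>
    convert comp_mem (AddMonoidHom.inl V (Fin 0 → ℤ × ℤ)) hf using 1
    funext x
    rw [Fintype.piFinset_of_isEmpty, Finset.univ_unique, Finset.sum_singleton]
    exact congrArg (fun z => f (x, z)) (Subsingleton.elim _ _)
  | succ m ih =>
    let c : ((V × ℤ) × ℤ) × (Fin m → ℤ × ℤ) →+ V × (Fin (m + 1) → ℤ × ℤ) :=
      AddMonoidHom.mk' (fun t => (t.1.1.1, Fin.cons (t.1.1.2, t.1.2) t.2)) fun s t => by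
        refine Prod.ext rfl (funext fun a => ?_)
        refine Fin.cases ?_ (fun b => ?_) a <;> simp
    have h := ih (V := (V × ℤ) × ℤ)
      (ν.comp ((AddMonoidHom.fst V ℤ).comp (AddMonoidHom.fst (V × ℤ) ℤ))) (comp_mem c hf)
    have h2 := sum_Ioc_mem ν (sum_Ioc_mem (ν.comp (AddMonoidHom.fst V ℤ)) h)
    convert h2 using 1
    funext x
    rw [sum_piFinset_succ, Finset.sum_product]
    rfl

end Sums

/-- Each move has a coordinate ±1, from which the integer multiple can be read off; attacking is
thus a linear condition without a congruence. -/
theorem attacks_iff {M : Finset (ℤ × ℤ)} (hM : M ⊆ nightriderMoves) (z w : ℤ × ℤ) :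
    Attacks M z w ↔ ∃ m ∈ M, (w.1 - z.1) * m.2 - (w.2 - z.2) * m.1 = 0 := by
  refine exists_congr fun m => and_congr_right fun hm => ⟨?_, fun h => ?_⟩
  · rintro ⟨r, hr⟩
    have h1 := congrArg Prod.fst hr
    have h2 := congrArg Prod.snd hr
    simp only [Prod.fst_sub, Prod.snd_sub, Prod.smul_fst, Prod.smul_snd, smul_eq_mul] at h1 h2
    rw [h1, h2]
    ring
  · have hm' := hM hm
    simp only [nightriderMoves, Finset.mem_insert, Finset.mem_singleton] at hm'
    rcases hm' with rfl | rfl | rfl | rfl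
    · exact ⟨w.1 - z.1, by ext <;> simp at h ⊢; linarith⟩
    · exact ⟨w.2 - z.2, by ext <;> simp at h ⊢; linarith⟩
    · exact ⟨w.1 - z.1, by ext <;> simp at h ⊢; linarith⟩
    · exact ⟨z.2 - w.2, by ext <;> simp at h ⊢; linarith⟩

theorem exists_labelledCount_eq_eval {M : Finset (ℤ × ℤ)} (hM : M ⊆ nightriderMoves) (q : ℕ) :
    ∃ p : ℕ, 0 < p ∧ ∃ Q : ℕ → ℚ[X], Function.Periodic Q p ∧
      ∀ n : ℕ, 1 ≤ n → (labelledCount M q n : ℚ) = (Q n).eval (n : ℚ) := by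
  classical
  let ℓ : (Fin q × Fin q) × (ℤ × ℤ) → ℤ × (Fin q → ℤ × ℤ) →+ ℤ := fun t =>
    AddMonoidHom.mk' (fun x => ((x.2 t.1.2).1 - (x.2 t.1.1).1) * t.2.2 -
      ((x.2 t.1.2).2 - (x.2 t.1.1).2) * t.2.1) fun x y => by simp; ring
  let s : Finset ((Fin q × Fin q) × (ℤ × ℤ)) :=
    (Finset.univ.filter fun t : Fin q × Fin q => t.1 ≠ t.2) ×ˢ M
  let E : (Fin q × Fin q) × (ℤ × ℤ) → ℤ × (Fin q → ℤ × ℤ) → ℚ := fun t =>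
    (fun _ => 1) - fun x => if ℓ t x = 0 then 1 else 0
  let F : ℤ × (Fin q → ℤ × ℤ) → ℚ := ∏ t ∈ s, E t
  have hF : F ∈ piecewiseQuasiPoly (ℤ × (Fin q → ℤ × ℤ)) :=
    prod_mem fun t _ => sub_mem (const_mem 1) (ite_eq_zero_mem _)
  obtain ⟨g, ⟨d, hd, Q, hQ, hgQ⟩, hg⟩ :=
    exists_isQuasiPoly_of_mem (sum_piFinset_mem q (AddMonoidHom.id ℤ) hF)
  refine ⟨d, hd, fun n => Q n, fun n => by simpa using hQ n, fun n hn => ?_⟩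
  have h1 := hg n (by omega)
  rw [hgQ] at h1
  simp only [Int.cast_natCast] at h1
  rw [← h1, labelledCount, Finset.card_filter]
  push_cast
  have hb : (board n) = Finset.Ioc (0 : ℤ) n ×ˢ Finset.Ioc (0 : ℤ) n := by
    ext x
    simp only [board, Finset.mem_product, Finset.mem_Icc, Finset.mem_Ioc]
    omega
  rw [hb]
  refine Finset.sum_congr rfl fun z _ => ?_
  have hterm : ∀ t ∈ s, E t ((n : ℤ), z) =
      if ℓ t ((n : ℤ), z) ≠ 0 then 1 else 0 := fun t _ => by
    by_cases h : ℓ t ((n : ℤ), z) = 0 <;> simp [E, h]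
  simp only [F]
  rw [Finset.prod_apply, Finset.prod_congr rfl hterm, Finset.prod_ite_zero, Finset.prod_const_one]
  refine if_congr ⟨fun h t ht h0 => ?_, fun h a b hab hatt => ?_⟩ rfl rfl
  · simp only [s, Finset.mem_product, Finset.mem_filter, Finset.mem_univ, true_and] at ht
    exact h _ _ ht.1 ((attacks_iff hM _ _).2 ⟨t.2, ht.2, h0⟩)
  · obtain ⟨m, hm, h0⟩ := (attacks_iff hM _ _).1 hatt
    exact h ((a, b), m) (by simp [s, hab, hm]) h0

/-! ### Degree and coefficients of a quasipolynomial read off from its growth. -/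

section Growth

variable {p : ℕ} {Q : ℕ → ℚ[X]}

theorem periodic_add_mul (hQ : Function.Periodic Q p) (n j : ℕ) : Q (n + j * p) = Q n := by
  simpa using hQ.nat_mul j n

theorem tendsto_add_mul (hp : 0 < p) (n : ℕ) :
    Filter.Tendsto (fun j : ℕ => ((n + j * p : ℕ) : ℚ)) Filter.atTop Filter.atTop := by
  refine tendsto_natCast_atTop_atTop.comp (Filter.tendsto_atTop_mono (fun j => ?_) Filter.tendsto_id)
  simp only [id]
  nlinarith

theorem natDegree_le_of_growth (hp : 0 < p) (hQ : Function.Periodic Q p) {d : ℕ} {C : ℚ}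
    (h : ∀ n : ℕ, 1 ≤ n → |(Q n).eval (n : ℚ)| ≤ C * (n : ℚ) ^ d) (n : ℕ) :
    (Q n).natDegree ≤ d := by
  by_contra! hlt
  have hdeg : (Polynomial.X ^ d : ℚ[X]).degree < (Q n).degree := by
    rw [Polynomial.degree_X_pow]
    exact Polynomial.coe_lt_degree.2 hlt
  have h1 := (Polynomial.abs_div_tendsto_atTop_atTop_of_degree_gt _ _ hdeg
    (pow_ne_zero d Polynomial.X_ne_zero)).comp (tendsto_add_mul hp n)
  obtain ⟨j, hj, hj1⟩ := ((h1.eventually_gt_atTop C).and (Filter.eventually_ge_atTop 1)).exists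
  have hpos : 1 ≤ n + j * p := by nlinarith
  have h2 := h (n + j * p) hpos
  rw [periodic_add_mul hQ] at h2
  simp only [Function.comp_apply, Polynomial.eval_pow, Polynomial.eval_X, abs_div] at hj
  have hx : (0 : ℚ) < ((n + j * p : ℕ) : ℚ) ^ d := by positivity
  rw [abs_of_pos hx, lt_div_iff₀ hx] at hj
  linarith

theorem coeff_eq_of_growth (hp : 0 < p) (hQ : Function.Periodic Q p) {d : ℕ} {c C : ℚ}
    (h : ∀ n : ℕ, 1 ≤ n → |(Q n).eval (n : ℚ) - c * (n : ℚ) ^ d| * n ≤ C * (n : ℚ) ^ d) (n : ℕ) :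
    (Q n).coeff d = c := by
  -- The extra factor X turns an error of order n^(d-1) into a degree bound d, which avoids the
  -- exponent d - 1 when d = 0.
  have h1 := natDegree_le_of_growth (Q := fun n =>
    (Q n - Polynomial.C c * Polynomial.X ^ d) * Polynomial.X) hp (d := d) (C := C)
    (fun n => by simp only [hQ n]) (fun n hn => by simpa [abs_mul] using h n hn) n
  set R := Q n - Polynomial.C c * Polynomial.X ^ d with hR
  have h2 : R.coeff d = (Q n).coeff d - c := by simp [hR]
  have h3 : R.coeff d = 0 := by
    rw [← Polynomial.coeff_mul_X]
    exact Polynomial.coeff_eq_zero_of_natDegree_lt (by omega)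
  linarith

/-- Along n + (j+1) p p' both families are constant, so two polynomials agree at infinitely many
points. The shift j + 1 keeps these points positive even for n = 0. -/
theorem eq_of_eval_eq {p' : ℕ} {Q' : ℕ → ℚ[X]} (hp : 0 < p) (hQ : Function.Periodic Q p)
    (hp' : 0 < p') (hQ' : Function.Periodic Q' p')
    (h : ∀ n : ℕ, 1 ≤ n → (Q n).eval (n : ℚ) = (Q' n).eval (n : ℚ)) : Q = Q' := by
  funext n
  refine Polynomial.eq_of_infinite_eval_eq _ _ (Set.infinite_of_injective_forall_mem
    (f := fun j : ℕ => ((n + (j + 1) * (p * p') : ℕ) : ℚ)) (fun i j hij => ?_) fun j => ?_)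
  · simp only [Nat.cast_inj] at hij
    have hpp : 0 < p * p' := by positivity
    have := Nat.eq_of_mul_eq_mul_right hpp (Nat.add_left_cancel hij)
    omega
  · have h1 := h (n + (j + 1) * (p * p')) (by nlinarith [Nat.mul_pos hp hp'])
    have e1 : Q (n + (j + 1) * (p * p')) = Q n := by
      have := periodic_add_mul hQ n ((j + 1) * p')
      rwa [show (j + 1) * p' * p = (j + 1) * (p * p') by ring] at this
    have e2 : Q' (n + (j + 1) * (p * p')) = Q' n := by
      have := periodic_add_mul hQ' n ((j + 1) * p)
      rwa [mul_assoc] at this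
    rw [e1, e2] at h1
    exact h1

end Growth

/-! ### The binomial transform as a signed count of independent sets. -/

/-- The number of functions `ι → T` no two of whose values are related by `R`. -/
noncomputable def independentCount {T : Type*} (R : T → T → Prop) (ι : Type*) : ℕ :=
  Nat.card {z : ι → T // ∀ a b, a ≠ b → ¬ R (z a) (z b)}

/-- The graph on the indices of `z` that joins `a` and `b` if `z a` and `z b` are related. -/
def relationGraph {T ι : Type*} (R : T → T → Prop) (hR : ∀ ⦃x y⦄, R x y → R y x) (z : ι → T) :
    SimpleGraph ι where
  Adj a b := a ≠ b ∧ R (z a) (z b)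
  symm := ⟨fun _ _ h => ⟨h.1.symm, hR h.2⟩⟩
  loopless := ⟨fun _ h => h.1 rfl⟩

open Classical in
/-- The signed number of independent sets of a graph. -/
noncomputable def signedIndependent {ι : Type*} [Fintype ι] (G : SimpleGraph ι) : ℚ :=
  ∑ W : Finset ι, if ∀ a ∈ W, ∀ b ∈ W, ¬ G.Adj a b then (-1) ^ (Fintype.card ι - W.card)
    else 0

section Expansion

theorem independentCount_congr {T ι κ : Type*} (R : T → T → Prop) (e : ι ≃ κ) :
    independentCount R ι = independentCount R κ := by
  refine Nat.card_congr ((Equiv.arrowCongr e (Equiv.refl T)).subtypeEquiv fun z => ?_)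
  constructor
  · intro h a b hab
    exact h _ _ fun h' => hab (e.symm.injective h')
  · intro h a b hab
    simpa using h (e a) (e b) fun h' => hab (e.injective h')

variable {T : Type*} [Fintype T] {ι : Type*} [Fintype ι]

theorem card_independent_on [DecidableEq ι] (R : T → T → Prop) (W : Finset ι) :
    Nat.card {z : ι → T // ∀ a ∈ W, ∀ b ∈ W, a ≠ b → ¬ R (z a) (z b)} =
      Fintype.card T ^ (Fintype.card ι - W.card) * independentCount R (Fin W.card) := by
  rw [independentCount_congr R W.equivFin.symm]
  let e := Equiv.piEquivPiSubtypeProd (· ∈ W) fun _ : ι => T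
  have h1 : Nat.card {z : ι → T // ∀ a ∈ W, ∀ b ∈ W, a ≠ b → ¬ R (z a) (z b)} =
      Nat.card {p : (({a // a ∈ W} → T) × ({a // a ∉ W} → T)) //
        ∀ a b, a ≠ b → ¬ R (p.1 a) (p.1 b)} := by
    refine Nat.card_congr (e.subtypeEquiv fun z => ?_)
    constructor
    · intro h a b hab
      exact h a a.2 b b.2 fun h' => hab (Subtype.ext h')
    · intro h a ha b hb hab
      exact h ⟨a, ha⟩ ⟨b, hb⟩ fun h' => hab (congrArg Subtype.val h')
  rw [h1, Nat.card_congr (Equiv.prodSubtypeFstEquivSubtypeProd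
    (p := fun y : {a // a ∈ W} → T => ∀ a b, a ≠ b → ¬ R (y a) (y b))), Nat.card_prod,
    mul_comm, Nat.card_fun, Nat.card_eq_fintype_card, Nat.card_eq_fintype_card,
    Fintype.card_subtype_compl, Fintype.card_coe]
  rfl

/-- Double counting of pairs (z, W) with `W` independent in the graph of `z`: the coordinates
outside `W` are free and account for the power of |T|. -/
theorem sum_choose_independentCount [DecidableEq ι] (R : T → T → Prop) (hR : ∀ ⦃x y⦄, R x y → R y x) :
    ∑ j ∈ Finset.range (Fintype.card ι + 1), ((Fintype.card ι).choose j : ℚ) *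
        (-(Fintype.card T : ℚ)) ^ (Fintype.card ι - j) * (independentCount R (Fin j) : ℚ) =
      ∑ z : ι → T, signedIndependent (relationGraph R hR z) := by
  classical
  have h := Finset.sum_powerset_apply_card (x := (Finset.univ : Finset ι)) (fun j =>
    (-(Fintype.card T : ℚ)) ^ (Fintype.card ι - j) * (independentCount R (Fin j) : ℚ))
  simp only [Finset.card_univ, nsmul_eq_mul, ← mul_assoc, Finset.powerset_univ] at h
  rw [← h]
  simp only [signedIndependent]
  rw [Finset.sum_comm]
  refine Finset.sum_congr rfl fun W _ => ?_
  have h3 : (Finset.univ.filter fun z : ι → T => ∀ a ∈ W, ∀ b ∈ W,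
      ¬ (relationGraph R hR z).Adj a b).card =
      Fintype.card T ^ (Fintype.card ι - W.card) * independentCount R (Fin W.card) := by
    rw [← card_independent_on, ← Fintype.card_subtype, ← Nat.card_eq_fintype_card]
    simp only [relationGraph, not_and]
  trans ∑ z : ι → T with ∀ a ∈ W, ∀ b ∈ W, ¬ (relationGraph R hR z).Adj a b,
    (-1 : ℚ) ^ (Fintype.card ι - W.card)
  · rw [Finset.sum_const, h3, nsmul_eq_mul, neg_pow]
    push_cast
    ring
  · rw [Finset.sum_filter]
    congr!

/-- Toggling the isolated vertex in `W` preserves independence and reverses the sign. -/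
theorem signedIndependent_eq_zero {G : SimpleGraph ι} {v : ι} (hv : ∀ w, ¬ G.Adj v w) :
    signedIndependent G = 0 := by
  classical
  have hv' : ∀ w, ¬ G.Adj w v := fun w h => hv w h.symm
  have key : ∀ W : Finset ι, v ∉ W →
      (if ∀ a ∈ insert v W, ∀ b ∈ insert v W, ¬ G.Adj a b then
        (-1 : ℚ) ^ (Fintype.card ι - (insert v W).card) else 0) =
      -if ∀ a ∈ W, ∀ b ∈ W, ¬ G.Adj a b then (-1 : ℚ) ^ (Fintype.card ι - W.card) else 0 := fun W hW => by
    have h1 : (∀ a ∈ insert v W, ∀ b ∈ insert v W, ¬ G.Adj a b) ↔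
        ∀ a ∈ W, ∀ b ∈ W, ¬ G.Adj a b := by simp [hv, hv']
    have h2 : Fintype.card ι - W.card = Fintype.card ι - (insert v W).card + 1 := by
      have h3 := Finset.card_insert_of_notMem hW
      have h4 := Finset.card_le_univ (insert v W)
      omega
    simp only [h1, h2, pow_succ]
    split_ifs <;> ring
  rw [signedIndependent]
  refine Finset.sum_involution (fun W _ => if v ∈ W then W.erase v else insert v W) ?_ ?_ ?_ ?_
  · intro W _
    by_cases hW : v ∈ W
    · have := key (W.erase v) (by simp)
      rw [Finset.insert_erase hW] at this
      simp only [if_pos hW]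
      rw [this]
      ring
    · simp only [if_neg hW]
      rw [key W hW]
      ring
  · intro W _ _ h
    by_cases hW : v ∈ W
    · simp only [if_pos hW] at h
      exact (Finset.erase_eq_self.1 h) hW
    · simp only [if_neg hW] at h
      exact hW (Finset.insert_eq_self.1 h)
  · simp
  · intro W _
    by_cases hW : v ∈ W
    · simp [hW, Finset.insert_erase]
    · simp [hW]

theorem abs_signedIndependent_le (G : SimpleGraph ι) :
    |signedIndependent G| ≤ 2 ^ Fintype.card ι := by
  classical
  refine (Finset.abs_sum_le_sum_abs _ _).trans ?_
  have : (2 : ℚ) ^ Fintype.card ι = ∑ _W : Finset ι, (1 : ℚ) := by simp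
  rw [this]
  refine Finset.sum_le_sum fun W _ => ?_
  split_ifs <;> simp [abs_pow]

theorem signedIndependent_comap (G : SimpleGraph ι) (σ : ι ≃ ι) :
    signedIndependent (G.comap σ) = signedIndependent G := by
  classical
  refine Fintype.sum_equiv σ.finsetCongr _ _ fun W => ?_
  have h1 : (σ.finsetCongr W).card = W.card := by simp
  have h2 : (∀ a ∈ σ.finsetCongr W, ∀ b ∈ σ.finsetCongr W, ¬ G.Adj a b) ↔
      ∀ a ∈ W, ∀ b ∈ W, ¬ (G.comap σ).Adj a b := by
    rw [Equiv.finsetCongr_apply]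
    simp only [Finset.forall_mem_map, Equiv.coe_toEmbedding, SimpleGraph.comap_adj]
  rw [h1]
  exact if_congr h2.symm rfl rfl

end Expansion

/-! ### Perfect matchings, as fixed point free involutions. -/

section Matching

/-- The involution of `Fin i × Bool` that exchanges the two elements of each pair. -/
def pairSwap (i : ℕ) : Equiv.Perm (Fin i × Bool) where
  toFun x := (x.1, !x.2)
  invFun x := (x.1, !x.2)
  left_inv x := by simp
  right_inv x := by simp

theorem cycleType_eq_replicate_iff {i : ℕ} (π : Equiv.Perm (Fin i × Bool)) :
    π.cycleType = Multiset.replicate i 2 ↔ (∀ a, π (π a) = a) ∧ ∀ a, π a ≠ a := by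
  have : Fact (Nat.Prime 2) := ⟨Nat.prime_two⟩
  have hpow : (∀ a, π (π a) = a) ↔ ∀ c ∈ π.cycleType, c = 2 := by
    rw [← Equiv.Perm.pow_prime_eq_one_iff, Equiv.ext_iff]
    simp [pow_two]
  rw [hpow]
  have hsum := π.sum_cycleType
  constructor
  · intro h
    refine ⟨fun c hc => Multiset.eq_of_mem_replicate (h ▸ hc), ?_⟩
    rw [h] at hsum
    have : π.support = Finset.univ := by
      rw [← Finset.card_eq_iff_eq_univ, ← hsum]
      simp
    intro a
    rw [← Equiv.Perm.mem_support, this]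
    exact Finset.mem_univ a
  · rintro ⟨h1, h2⟩
    have h3 := Multiset.eq_replicate_card.2 h1
    have h4 : π.support = Finset.univ := Finset.eq_univ_iff_forall.2 fun a =>
      Equiv.Perm.mem_support.2 (h2 a)
    rw [h3, h4] at hsum
    simp at hsum
    rw [h3, hsum]

open Classical in
/-- The fixed point free involutions of `Fin i × Bool`. -/
noncomputable def matchings (i : ℕ) : Finset (Equiv.Perm (Fin i × Bool)) :=
  Finset.univ.filter fun π => (∀ a, π (π a) = a) ∧ ∀ a, π a ≠ a

theorem card_matchings (i : ℕ) : (matchings i).card * (2 ^ i * i !) = (2 * i)! := by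
  classical
  have h := Equiv.Perm.card_of_cycleType_mul_eq (Fin i × Bool) (Multiset.replicate i 2)
  have hcard : Fintype.card (Fin i × Bool) = 2 * i := by simp [mul_comm]
  rw [if_pos ⟨by simp, fun a ha => (Multiset.eq_of_mem_replicate ha).ge⟩, hcard] at h
  have hm : matchings i = Finset.univ.filter fun π : Equiv.Perm (Fin i × Bool) =>
      π.cycleType = Multiset.replicate i 2 :=
    Finset.filter_congr fun π _ => (cycleType_eq_replicate_iff π).symm
  have hprod : (∏ n ∈ (Multiset.replicate i 2).toFinset, (Multiset.count n (Multiset.replicate i 2))!)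
      = i ! := by
    rcases Nat.eq_zero_or_pos i with rfl | hi
    · simp
    · rw [Multiset.toFinset_replicate, if_neg hi.ne']
      simp
  rw [hprod, Multiset.sum_replicate, Multiset.prod_replicate, smul_eq_mul, mul_comm i 2,
    Nat.sub_self, Nat.factorial_zero, one_mul] at h
  rw [hm, ← h]

theorem exists_conj_pairSwap {i : ℕ} {π : Equiv.Perm (Fin i × Bool)} (hπ : π ∈ matchings i) :
    ∃ σ : Equiv.Perm (Fin i × Bool), ∀ a, π (σ a) = σ (pairSwap i a) := by
  classical
  have h1 := (cycleType_eq_replicate_iff π).2 (Finset.mem_filter.1 hπ).2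
  have h2 := (cycleType_eq_replicate_iff (pairSwap i)).2
    ⟨fun a => by simp [pairSwap], fun a h => by simp [pairSwap, Prod.ext_iff] at h⟩
  obtain ⟨σ, hσ⟩ := isConj_iff.1 (Equiv.Perm.isConj_iff_cycleType_eq.2 (h2.trans h1.symm))
  exact ⟨σ, fun a => by rw [← hσ]; simp⟩

/-- The signed count factors over the i edges. A single edge contributes 1 - 1 - 1 = -1, from the
empty set and the two singletons. -/
theorem signedIndependent_pairSwap {i : ℕ} {G : SimpleGraph (Fin i × Bool)}
    (hG : ∀ a b, G.Adj a b ↔ b = pairSwap i a) : signedIndependent G = (-1) ^ i := by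
  classical
  let v : Finset Bool → ℚ := fun s => if s ≠ Finset.univ then (-1) ^ (2 - s.card) else 0
  have hB : ∑ s, v s = -1 := by
    have : (Finset.univ : Finset (Finset Bool)) = {∅, {true}, {false}, {true, false}} := by decide
    rw [this, Finset.sum_insert (by decide), Finset.sum_insert (by decide),
      Finset.sum_insert (by decide), Finset.sum_singleton]
    have h0 : v ∅ = 1 := by simp only [v]; rw [if_pos (by decide)]; norm_num
    have h1 : v {true} = -1 := by simp only [v]; rw [if_pos (by decide)]; norm_num
    have h2 : v {false} = -1 := by simp only [v]; rw [if_pos (by decide)]; norm_num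
    have h3 : v {true, false} = 0 := by simp only [v]; rw [if_neg (by decide)]
    rw [h0, h1, h2, h3]
    norm_num
  rw [← hB, Fintype.sum_pow, signedIndependent]
  refine Finset.sum_nbij' (fun W j => Finset.univ.filter fun b => (j, b) ∈ W)
    (fun p => Finset.univ.filter fun x => x.2 ∈ p x.1) (by simp) (by simp) ?_ ?_ ?_
  · intro W _
    ext x
    simp
  · intro p _
    funext j
    ext b
    simp
  · intro W _
    have h1 : (∀ a ∈ W, ∀ b ∈ W, ¬ G.Adj a b) ↔
        ∀ j ∈ (Finset.univ : Finset (Fin i)),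
          (Finset.univ.filter fun b => (j, b) ∈ W) ≠ Finset.univ := by
      simp only [Finset.mem_univ, true_imp_iff, hG, ne_eq, Finset.filter_eq_self]
      constructor
      · intro h j hj
        exact h (j, true) (hj true) (j, false) (hj false) rfl
      · rintro h ⟨j, b⟩ ha _ hb rfl
        refine h j fun c => ?_
        simp only [pairSwap, Equiv.coe_fn_mk] at hb
        cases b <;> cases c <;> simp_all
    have h2 : (-1 : ℚ) ^ (Fintype.card (Fin i × Bool) - W.card) =
        ∏ j : Fin i, (-1 : ℚ) ^ (2 - (Finset.univ.filter fun b => (j, b) ∈ W).card) := by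
      rw [Finset.prod_pow_eq_pow_sum]
      congr 1
      have h3 : ∀ s : Finset Bool, 2 - s.card = sᶜ.card := fun s => by
        rw [Finset.card_compl, Fintype.card_bool]
      rw [← Finset.card_compl, ← Finset.filter_univ_mem Wᶜ, Finset.card_filter,
        Fintype.sum_prod_type]
      refine Finset.sum_congr rfl fun j _ => ?_
      rw [h3, Finset.compl_filter, Finset.card_filter]
      simp only [Finset.mem_compl]
    rw [h2]
    simp only [v]
    rw [Finset.prod_ite_zero]
    by_cases h : ∀ a ∈ W, ∀ b ∈ W, ¬ G.Adj a b
    · rw [if_pos h, if_pos (h1.1 h)]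
    · rw [if_neg h, if_neg (mt h1.2 h)]

theorem signedIndependent_matching {i : ℕ} {π : Equiv.Perm (Fin i × Bool)} (hπ : π ∈ matchings i)
    {G : SimpleGraph (Fin i × Bool)} (hG : ∀ a b, G.Adj a b ↔ b = π a) :
    signedIndependent G = (-1) ^ i := by
  obtain ⟨σ, hσ⟩ := exists_conj_pairSwap hπ
  rw [← signedIndependent_comap G σ]
  refine signedIndependent_pairSwap fun a b => ?_
  rw [SimpleGraph.comap_adj, hG, hσ, σ.apply_eq_iff_eq]

-- All matchings are conjugate to `pairSwap`, for which a compatible `z` is a free choice of one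
-- related ordered pair per edge.
open Classical in
theorem card_matched {T : Type*} [Fintype T] (R : T → T → Prop) (hR : ∀ ⦃x y⦄, R x y → R y x) {i : ℕ}
    {π : Equiv.Perm (Fin i × Bool)} (hπ : π ∈ matchings i) :
    (Finset.univ.filter fun z : Fin i × Bool → T => ∀ a, R (z a) (z (π a))).card =
      (Finset.univ.filter fun p : T × T => R p.1 p.2).card ^ i := by
  obtain ⟨σ, hσ⟩ := exists_conj_pairSwap hπ
  have h1 : Fintype.card {z : Fin i × Bool → T // ∀ a, R (z a) (z (π a))} =
      Fintype.card {z : Fin i × Bool → T // ∀ a, R (z a) (z (pairSwap i a))} := by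
    refine Fintype.card_congr ((Equiv.arrowCongr σ.symm (Equiv.refl T)).subtypeEquiv fun z => ?_)
    constructor
    · intro h a
      have := h (σ a)
      rw [hσ] at this
      exact this
    · intro h a
      have : R (z (σ (σ.symm a))) (z (σ (pairSwap i (σ.symm a)))) := h (σ.symm a)
      rwa [← hσ, σ.apply_symm_apply] at this
  have h2 : {z : Fin i × Bool → T // ∀ a, R (z a) (z (pairSwap i a))} ≃
      (Fin i → {p : T × T // R p.1 p.2}) :=
    { toFun := fun z j => ⟨(z.1 (j, true), z.1 (j, false)), z.2 (j, true)⟩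
      invFun := fun y => ⟨fun x => if x.2 then (y x.1).1.1 else (y x.1).1.2, fun x => by
        rcases x with ⟨j, b⟩
        cases b
        · exact hR (y j).2
        · exact (y j).2⟩
      left_inv := fun z => by
        ext x
        rcases x with ⟨j, b⟩
        cases b <;> rfl
      right_inv := fun y => by
        funext j
        rfl }
  rw [← Fintype.card_subtype, ← Fintype.card_subtype, h1, Fintype.card_congr h2, Fintype.card_fun,
    Fintype.card_fin]

end Matching

/-! ### Connected components and the number of placements compatible with a graph. -/

section Components

variable {ι : Type*} (G : SimpleGraph ι)

/-- The chosen representative of the connected component of `v`. -/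
noncomputable def componentRoot (v : ι) : ι := (G.connectedComponentMk v).out

theorem componentRoot_reachable (v : ι) : G.Reachable (componentRoot G v) v :=
  SimpleGraph.ConnectedComponent.exact (Quot.out_eq _)

variable {G} in
theorem componentRoot_eq {v w : ι} (h : G.Reachable v w) : componentRoot G v = componentRoot G w := by
  rw [componentRoot, componentRoot, SimpleGraph.ConnectedComponent.sound h]

variable [Fintype ι]

open Classical in
/-- The set of representatives of connected components. -/
noncomputable def roots : Finset ι := Finset.univ.filter fun v => componentRoot G v = v

theorem exists_parent {v : ι} (hv : v ∉ roots G) : ∃ p, G.Adj p v ∧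
    G.dist p (componentRoot G p) < G.dist v (componentRoot G v) := by
  have hne : componentRoot G v ≠ v := by simpa [roots] using hv
  obtain ⟨w, hw⟩ := (componentRoot_reachable G v).symm.exists_walk_length_eq_dist
  generalize hr : componentRoot G v = r at w hw hne
  cases w with
  | nil => exact absurd rfl hne
  | cons h w =>
    refine ⟨_, h.symm, ?_⟩
    rw [componentRoot_eq h.symm.reachable, hr, ← hw]
    exact (SimpleGraph.dist_le w).trans_lt (by simp)

-- Roots are chosen freely. Every other vertex has a neighbour closer to its root, whose value
-- leaves at most `D` choices; the encoding is injective by induction on the distance to the root.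
open Classical in
theorem card_compatible_le [DecidableEq ι] {T : Type*} [Fintype T] (R : T → T → Prop) {D : ℕ}
    (hD : ∀ t, (Finset.univ.filter fun s => R t s).card ≤ D) :
    (Finset.univ.filter fun z : ι → T => ∀ a b, G.Adj a b → R (z a) (z b)).card ≤
      Fintype.card T ^ (roots G).card * D ^ (Fintype.card ι - (roots G).card) := by
  have he : ∀ t, Nonempty ({s // R t s} ↪ Fin D) := fun t =>
    Function.Embedding.nonempty_of_card_le (by rw [Fintype.card_subtype]; simpa using hD t)
  let e := fun t => (he t).some
  have heq : ∀ t t' s s' (hs : R t s) (hs' : R t' s'), t = t' → e t ⟨s, hs⟩ = e t' ⟨s', hs'⟩ →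
      s = s' := by
    rintro t _ s s' hs hs' rfl h
    exact congrArg Subtype.val ((e t).injective h)
  choose p hp hdist using fun v : {v // v ∉ roots G} => exists_parent G v.2
  rw [← Fintype.card_subtype]
  let code : {z : ι → T // ∀ a b, G.Adj a b → R (z a) (z b)} →
      ({v // v ∈ roots G} → T) × ({v // v ∉ roots G} → Fin D) := fun z =>
    (fun v => z.1 v, fun v => e (z.1 (p v)) ⟨z.1 v, z.2 _ _ (hp v)⟩)
  have hinj : Function.Injective code := by
    intro z z' h
    have h1 := fun v => congrFun (congrArg Prod.fst h) v
    have h2 := fun v => congrFun (congrArg Prod.snd h) v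
    have key : ∀ N v, G.dist v (componentRoot G v) = N → z.1 v = z'.1 v := by
      intro N
      induction N using Nat.strong_induction_on with
      | _ N ih =>
        intro v hN
        by_cases hv : v ∈ roots G
        · exact h1 ⟨v, hv⟩
        · exact heq _ _ _ _ _ _ (ih _ (hN ▸ hdist ⟨v, hv⟩) _ rfl) (h2 ⟨v, hv⟩)
    exact Subtype.ext (funext fun v => key _ v rfl)
  refine (Fintype.card_le_of_injective code hinj).trans_eq ?_
  rw [Fintype.card_prod, Fintype.card_fun, Fintype.card_fun, Fintype.card_fin, Fintype.card_coe]
  congr 2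
  rw [Fintype.card_subtype_compl, Fintype.card_coe]

/-- Sending each root to one of its neighbours embeds the roots into the non-roots. If this exhausts
all vertices, every component is a single edge. -/
theorem card_roots_le (hG : ∀ v, ∃ w, G.Adj v w) :
    2 * (roots G).card ≤ Fintype.card ι ∧ (2 * (roots G).card = Fintype.card ι →
      ∃ f : ι → ι, ∀ v w, G.Adj v w ↔ w = f v) := by
  classical
  choose s hs using hG
  have hroot : ∀ {v}, v ∈ roots G → componentRoot G v = v := fun {v} h => by
    simpa [roots] using h
  have hsroot : ∀ {v}, v ∈ roots G → componentRoot G (s v) = v := fun {v} h => by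
    rw [← componentRoot_eq (hs v).reachable, hroot h]
  have hinj : Set.InjOn s (roots G) := fun v hv w hw h => by
    rw [← hsroot hv, h, hsroot hw]
  have hdisj : Disjoint (roots G) ((roots G).image s) := by
    rw [Finset.disjoint_left]
    intro w hw hw'
    obtain ⟨v, hv, rfl⟩ := Finset.mem_image.1 hw'
    have := hsroot hv
    rw [hroot hw] at this
    exact (hs v).ne this.symm
  have hcard : (roots G ∪ (roots G).image s).card = 2 * (roots G).card := by
    rw [Finset.card_union_of_disjoint hdisj, Finset.card_image_of_injOn hinj, two_mul]
  refine ⟨hcard ▸ Finset.card_le_univ _, fun h => ?_⟩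
  have huniv := (Finset.card_eq_iff_eq_univ _).1 (hcard.trans h)
  have hmem : ∀ v, v = componentRoot G v ∨ v = s (componentRoot G v) := fun v => by
    have hv : v ∈ roots G ∪ (roots G).image s := huniv ▸ Finset.mem_univ v
    rcases Finset.mem_union.1 hv with hv | hv
    · exact Or.inl (hroot hv).symm
    · obtain ⟨w, hw, rfl⟩ := Finset.mem_image.1 hv
      rw [hsroot hw]
      exact Or.inr rfl
  refine ⟨s, fun v w => ⟨fun hvw => ?_, fun hw => hw ▸ hs v⟩⟩
  have e1 := componentRoot_eq hvw.reachable
  have e2 := componentRoot_eq (hs v).reachable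
  have n1 := hvw.ne
  have n2 := (hs v).ne
  have m1 := hmem v
  have m2 := hmem w
  have m3 := hmem (s v)
  rw [← e1] at m2
  rw [← e2] at m3
  grind

end Components

/-! ### Growth of the binomial transform and its leading term. -/

section Bounds

variable {T : Type*} [Fintype T] (R : T → T → Prop) (hR : ∀ ⦃x y⦄, R x y → R y x) {ι : Type*} [Fintype ι] [DecidableEq ι]

/-- The placements are grouped by their graph, and only bad graphs contribute. The slack `s` records
a saving in the number of components without subtracting in the exponent. -/
theorem abs_sum_mul_le {n : ℕ} (hn : 1 ≤ n) (hT : Fintype.card T = n ^ 2)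
    (hD : ∀ t, {s | R t s}.ncard ≤ 12 * n) {g : (ι → T) → ℚ} {bad : SimpleGraph ι → Prop} {K : ℚ}
    (hK : ∀ z, |g z| ≤ K) (hg : ∀ z, ¬ bad (relationGraph R hR z) → g z = 0) {s e : ℕ}
    (hbad : ∀ G, bad G → (roots G).card + s ≤ e) :
    |∑ z, g z| * (n : ℚ) ^ s ≤
      Nat.card (SimpleGraph ι) * K * 12 ^ Fintype.card ι * (n : ℚ) ^ (Fintype.card ι + e) := by
  classical
  have hn' : (1 : ℚ) ≤ n := by exact_mod_cast hn
  have hK0 : 0 ≤ K := by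
    have : Nonempty T := Fintype.card_pos_iff.1 (by rw [hT]; positivity)
    exact (abs_nonneg _).trans (hK fun _ => this.some)
  have hfib : ∑ z, g z = ∑ G : SimpleGraph ι,
      ∑ z with relationGraph R hR z = G, g z :=
    (Finset.sum_fiberwise _ _ _).symm
  have hterm : ∀ G : SimpleGraph ι, |∑ z with relationGraph R hR z = G, g z| * (n : ℚ) ^ s ≤
      K * 12 ^ Fintype.card ι * (n : ℚ) ^ (Fintype.card ι + e) := by
    intro G
    by_cases hG : bad G
    · have hc : (Finset.univ.filter fun z => relationGraph R hR z = G).card ≤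
          12 ^ Fintype.card ι * n ^ (Fintype.card ι + (roots G).card) := by
        calc _ ≤ (Finset.univ.filter fun z : ι → T => ∀ a b, G.Adj a b → R (z a) (z b)).card := by
              refine Finset.card_le_card fun z hz => ?_
              simp only [Finset.mem_filter, Finset.mem_univ, true_and] at hz ⊢
              rintro a b hab
              rw [← hz] at hab
              exact hab.2
          _ ≤ _ := card_compatible_le G R (D := 12 * n) fun t => by
              rw [← Set.ncard_coe_finset]
              simpa using hD t
          _ ≤ _ := by
              have hle : (roots G).card ≤ Fintype.card ι := Finset.card_le_univ _
              rw [hT, mul_pow, ← pow_mul]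
              calc n ^ (2 * (roots G).card) * (12 ^ (Fintype.card ι - (roots G).card) *
                    n ^ (Fintype.card ι - (roots G).card))
                  = 12 ^ (Fintype.card ι - (roots G).card) *
                    n ^ (2 * (roots G).card + (Fintype.card ι - (roots G).card)) := by ring
                _ ≤ _ := by
                  have : 2 * (roots G).card + (Fintype.card ι - (roots G).card) =
                    Fintype.card ι + (roots G).card := by omega
                  rw [this]
                  gcongr
                  · norm_num
                  · omega
      have hsum : |∑ z with relationGraph R hR z = G, g z| ≤
          (12 ^ Fintype.card ι * (n : ℚ) ^ (Fintype.card ι + (roots G).card)) * K := by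
        refine (Finset.abs_sum_le_sum_abs _ _).trans ?_
        refine (Finset.sum_le_card_nsmul _ _ K fun z _ => hK z).trans ?_
        rw [nsmul_eq_mul]
        refine mul_le_mul_of_nonneg_right ?_ hK0
        exact_mod_cast hc
      calc _ ≤ (12 ^ Fintype.card ι * (n : ℚ) ^ (Fintype.card ι + (roots G).card)) * K *
              (n : ℚ) ^ s := by gcongr
        _ = K * 12 ^ Fintype.card ι * (n : ℚ) ^ (Fintype.card ι + ((roots G).card + s)) := by ring
        _ ≤ _ := by
          gcongr
          exact hbad G hG
    · rw [Finset.sum_eq_zero]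
      · simp only [abs_zero, zero_mul]
        positivity
      · intro z hz
        simp only [Finset.mem_filter, Finset.mem_univ, true_and] at hz
        exact hg z (hz ▸ hG)
  calc |∑ z, g z| * (n : ℚ) ^ s
      ≤ (∑ G : SimpleGraph ι, |∑ z with relationGraph R hR z = G, g z|) * (n : ℚ) ^ s := by
        rw [hfib]
        gcongr
        exact Finset.abs_sum_le_sum_abs _ _
    _ ≤ ∑ _G : SimpleGraph ι, K * 12 ^ Fintype.card ι * (n : ℚ) ^ (Fintype.card ι + e) := by
        rw [Finset.sum_mul]
        exact Finset.sum_le_sum fun G _ => hterm G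
    _ = _ := by
        rw [Finset.sum_const, Finset.card_univ, nsmul_eq_mul, Nat.card_eq_fintype_card]
        ring

theorem exists_abs_sum_signedIndependent_le (ι : Type*) [Fintype ι] [DecidableEq ι] : ∃ C : ℚ,
    ∀ {T : Type} [Fintype T] (R : T → T → Prop) (hR : ∀ ⦃x y⦄, R x y → R y x) {n : ℕ}, 1 ≤ n →
      Fintype.card T = n ^ 2 → (∀ t, {s | R t s}.ncard ≤ 12 * n) →
      |∑ z : ι → T, signedIndependent (relationGraph R hR z)| ≤
        C * (n : ℚ) ^ (Fintype.card ι + Fintype.card ι / 2) := by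
  refine ⟨Nat.card (SimpleGraph ι) * 2 ^ Fintype.card ι * 12 ^ Fintype.card ι,
    fun {T} _ R hR n hn hT hD => ?_⟩
  have := abs_sum_mul_le R hR hn hT hD (bad := fun G => ∀ v, ∃ w, G.Adj v w) (s := 0)
    (g := fun z : ι → T => signedIndependent (relationGraph R hR z))
    (fun z => abs_signedIndependent_le _) (fun z hz => by
      push Not at hz
      obtain ⟨v, hv⟩ := hz
      exact signedIndependent_eq_zero hv) (e := Fintype.card ι / 2) fun G hG => by
        have := (card_roots_le G hG).1
        omega
  simpa using this

-- From each placement's signed count one subtracts (-1)^i times the number of matchings compatible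
-- with it. The difference vanishes if there is an isolated vertex (no matching is compatible) and
-- if the graph is itself a matching (exactly one is). What remains has fewer than i components,
-- which saves a factor n.
open Classical in
theorem exists_abs_sum_sub_le (i : ℕ) : ∃ C : ℚ,
    ∀ {T : Type} [Fintype T] (R : T → T → Prop) (hR : ∀ ⦃x y⦄, R x y → R y x) {n : ℕ}, 1 ≤ n →
      Fintype.card T = n ^ 2 → (∀ t, {s | R t s}.ncard ≤ 12 * n) →
      |∑ z : Fin i × Bool → T, signedIndependent (relationGraph R hR z) -
        (-1) ^ i * (matchings i).card *
          ((Finset.univ.filter fun p : T × T => R p.1 p.2).card : ℚ) ^ i| * n ≤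
        C * (n : ℚ) ^ (3 * i) := by
  refine ⟨Nat.card (SimpleGraph (Fin i × Bool)) * (2 ^ Fintype.card (Fin i × Bool) +
    (matchings i).card) * 12 ^ Fintype.card (Fin i × Bool), fun {T} _ R hR n hn hT hD => ?_⟩
  have hcard : Fintype.card (Fin i × Bool) = 2 * i := by simp [mul_comm]
  let g : (Fin i × Bool → T) → ℚ := fun z => signedIndependent (relationGraph R hR z) -
    (-1) ^ i * ((matchings i).filter fun π => ∀ a, R (z a) (z (π a))).card
  have hgsum : ∑ z, g z = ∑ z : Fin i × Bool → T, signedIndependent (relationGraph R hR z) -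
        (-1) ^ i * (matchings i).card *
          ((Finset.univ.filter fun p : T × T => R p.1 p.2).card : ℚ) ^ i := by
    simp only [g]
    rw [Finset.sum_sub_distrib, ← Finset.mul_sum, mul_assoc]
    congr 2
    simp only [Finset.card_filter, Nat.cast_sum]
    rw [Finset.sum_comm]
    simp only [← Nat.cast_sum, ← Finset.card_filter]
    rw [Finset.sum_congr rfl fun π hπ => by rw [card_matched R hR hπ]]
    simp
  have hgK : ∀ z, |g z| ≤ 2 ^ Fintype.card (Fin i × Bool) + (matchings i).card := fun z => by
    refine (abs_sub _ _).trans (add_le_add (abs_signedIndependent_le _) ?_)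
    rw [abs_mul, abs_pow, abs_neg, abs_one, one_pow, one_mul, Nat.abs_cast]
    exact_mod_cast Finset.card_filter_le _ _
  have key := abs_sum_mul_le R hR hn hT hD (g := g) (s := 1) (e := i) (bad := fun G =>
    (∀ v, ∃ w, G.Adj v w) ∧ 2 * (roots G).card ≠ Fintype.card (Fin i × Bool)) hgK ?_ ?_
  · rw [hgsum, pow_one] at key
    refine key.trans_eq ?_
    congr 2
    rw [hcard]
    ring
  · intro z hz
    by_cases hiso : ∀ v, ∃ w, (relationGraph R hR z).Adj v w
    · have h2 : 2 * (roots (relationGraph R hR z)).card = Fintype.card (Fin i × Bool) := by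
        by_contra h
        exact hz ⟨hiso, h⟩
      obtain ⟨f, hf⟩ := (card_roots_le _ hiso).2 h2
      have hadj : ∀ v, (relationGraph R hR z).Adj v (f v) := fun v => (hf v _).2 rfl
      have hinv : Function.Involutive f := fun v => ((hf _ _).1 (hadj v).symm).symm
      have hmem : hinv.toPerm ∈ matchings i :=
        Finset.mem_filter.2 ⟨Finset.mem_univ _, hinv, fun a => (hadj a).ne'⟩
      have hs := signedIndependent_matching hmem hf
      have hone : (matchings i).filter (fun π => ∀ a, R (z a) (z (π a))) = {hinv.toPerm} := by
        refine Finset.eq_singleton_iff_unique_mem.2 ⟨Finset.mem_filter.2 ⟨hmem, fun a =>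
          (hadj a).2⟩, fun π hπ => Equiv.ext fun a => ?_⟩
        obtain ⟨h1, h3⟩ := Finset.mem_filter.1 hπ
        exact (hf _ _).1 ⟨((Finset.mem_filter.1 h1).2.2 a).symm, h3 a⟩
      simp only [g]
      rw [hs, hone]
      simp
    · push Not at hiso
      obtain ⟨v, hv⟩ := hiso
      have hnone : (matchings i).filter (fun π => ∀ a, R (z a) (z (π a))) = ∅ := by
        refine Finset.filter_eq_empty_iff.2 fun π hπ h => ?_
        exact hv (π v) ⟨((Finset.mem_filter.1 hπ).2.2 v).symm, h v⟩
      simp only [g]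
      rw [hnone, signedIndependent_eq_zero hv]
      simp
  · rintro G ⟨h1, h2⟩
    have := (card_roots_le G h1).1
    rw [hcard] at this h2
    omega

end Bounds

/-! ### Attacking pairs on the square board. -/

theorem Attacks.symm {M : Finset (ℤ × ℤ)} {z w : ℤ × ℤ} (h : Attacks M z w) : Attacks M w z := by
  obtain ⟨m, hm, r, hr⟩ := h
  exact ⟨m, hm, -r, by rw [neg_smul, ← hr, neg_sub]⟩

theorem mem_board {n : ℕ} {z : ℤ × ℤ} :
    z ∈ board n ↔ (1 ≤ z.1 ∧ z.1 ≤ n) ∧ (1 ≤ z.2 ∧ z.2 ≤ n) := by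
  simp [board, Finset.mem_product]

theorem card_board (n : ℕ) : (board n).card = n ^ 2 := by
  simp [board, Finset.card_product, pow_two]

theorem labelledCount_eq_independentCount (M : Finset (ℤ × ℤ)) (q n : ℕ) :
    labelledCount M q n =
      independentCount (fun z w : board n => Attacks M z w) (Fin q) := by
  classical
  rw [labelledCount, independentCount, ← Fintype.card_coe, ← Nat.card_eq_fintype_card]
  refine Nat.card_congr
    { toFun := fun z => ⟨fun a => ⟨z.1 a, Fintype.mem_piFinset.1 (Finset.mem_filter.1 z.2).1 a⟩,
        (Finset.mem_filter.1 z.2).2⟩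
      invFun := fun z => ⟨fun a => z.1 a, Finset.mem_filter.2
        ⟨Fintype.mem_piFinset.2 fun a => (z.1 a).2, z.2⟩⟩
      left_inv := fun z => rfl
      right_inv := fun z => rfl }

/-- At most four lines with 2n + 1 multiples each, and 4(2n + 1) ≤ 12n for n ≥ 1. -/
theorem ncard_attacked_le {M : Finset (ℤ × ℤ)} (hM : M ⊆ nightriderMoves) {n : ℕ} (hn : 1 ≤ n)
    (t : board n) : {s : board n | Attacks M t s}.ncard ≤ 12 * n := by
  classical
  let S : Finset (ℤ × ℤ) := (nightriderMoves ×ˢ Finset.Icc (-(n : ℤ)) n).image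
    fun p => (t : ℤ × ℤ) + p.2 • p.1
  have hS : S.card ≤ 12 * n := by
    refine Finset.card_image_le.trans ?_
    rw [Finset.card_product, Int.card_Icc]
    have : nightriderMoves.card = 4 := by decide
    rw [this]
    omega
  rw [← Set.ncard_image_of_injective _ Subtype.val_injective]
  refine le_trans ?_ hS
  rw [← Set.ncard_coe_finset]
  refine Set.ncard_le_ncard ?_ S.finite_toSet
  rintro _ ⟨s, ⟨m, hm, r, hr⟩, rfl⟩
  refine Finset.mem_coe.2 (Finset.mem_image.2 ⟨(m, r), Finset.mem_product.2 ⟨hM hm, ?_⟩, ?_⟩)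
  · have hs := mem_board.1 s.2
    have ht := mem_board.1 t.2
    have h1 := congrArg Prod.fst hr
    have hm' := hM hm
    simp only [nightriderMoves, Finset.mem_insert, Finset.mem_singleton] at hm'
    simp only [Prod.fst_sub, Prod.smul_fst, smul_eq_mul] at h1
    simp only [Finset.mem_Icc]
    rcases hm' with rfl | rfl | rfl | rfl <;> simp only at h1 <;> omega
  · simp only
    rw [← hr]
    abel

/-- The number of `z` in the board with `z + r • m` in the board, summed over `1 ≤ r ≤ n`, for a
basic move `m`. -/
def halfLineCount (n : ℕ) : ℕ := ∑ j ∈ Finset.range n, (n - (j + 1)) * (n - 2 * (j + 1))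

theorem card_filter_add_mem_board (n : ℕ) (v : ℤ × ℤ) :
    ((board n).filter fun z => z + v ∈ board n).card =
      (n - v.1.natAbs) * (n - v.2.natAbs) := by
  have : ((board n).filter fun z => z + v ∈ board n) =
      Finset.Icc (max 1 (1 - v.1)) (min (n : ℤ) (n - v.1)) ×ˢ
        Finset.Icc (max 1 (1 - v.2)) (min (n : ℤ) (n - v.2)) := by
    ext z
    simp only [Finset.mem_filter, mem_board, Finset.mem_product, Finset.mem_Icc, Prod.fst_add,
      Prod.snd_add]
    omega
  rw [this, Finset.card_product, Int.card_Icc, Int.card_Icc]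
  congr 1 <;> omega

theorem card_filter_add_smul_mem_board (n j : ℕ) {m : ℤ × ℤ} (hm : m ∈ nightriderMoves) {r : ℤ}
    (hr : r.natAbs = j) : ((board n).filter fun z => z + r • m ∈ board n).card =
      (n - j) * (n - 2 * j) := by
  rw [card_filter_add_mem_board]
  simp only [nightriderMoves, Finset.mem_insert, Finset.mem_singleton] at hm
  rcases hm with rfl | rfl | rfl | rfl <;>
    simp only [Prod.smul_fst, Prod.smul_snd, smul_eq_mul, Int.natAbs_mul, hr, Int.natAbs_neg,
      Int.natAbs_one, show Int.natAbs 2 = 2 from rfl, mul_one, mul_comm j 2] <;>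
    first | rfl | rw [mul_comm]

/-- The nonzero integer of absolute value `j + 1` with sign `b`. -/
def signedStep (s : ℕ × Bool) : ℤ := if s.2 then (s.1 : ℤ) + 1 else -((s.1 : ℤ) + 1)

theorem signedStep_injective : Function.Injective signedStep := by
  rintro ⟨i, a⟩ ⟨j, b⟩ h
  cases a <;> cases b <;> simp [signedStep] at h ⊢ <;> omega

theorem exists_signedStep_eq {r : ℤ} (hr : r ≠ 0) : ∃ s, signedStep s = r ∧ s.1 + 1 = r.natAbs := by
  rcases lt_or_gt_of_ne hr with h | h
  · exact ⟨(r.natAbs - 1, false), by simp [signedStep]; omega, by simp; omega⟩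
  · exact ⟨(r.natAbs - 1, true), by simp [signedStep]; omega, by simp; omega⟩

theorem eq_of_smul_eq_smul {m m' : ℤ × ℤ} (hm : m ∈ nightriderMoves) (hm' : m' ∈ nightriderMoves)
    {r r' : ℤ} (hr : r ≠ 0) (h : r • m = r' • m') : m = m' ∧ r = r' := by
  have h1 := congrArg Prod.fst h
  have h2 := congrArg Prod.snd h
  simp only [Prod.smul_fst, Prod.smul_snd, smul_eq_mul] at h1 h2
  simp only [nightriderMoves, Finset.mem_insert, Finset.mem_singleton] at hm hm'
  rcases hm with rfl | rfl | rfl | rfl <;> rcases hm' with rfl | rfl | rfl | rfl <;>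
    simp only at h1 h2 <;> first | exact ⟨rfl, by omega⟩ | (exfalso; omega)

-- Off the diagonal, the move and the nonzero multiple are determined by the pair, because distinct
-- moves are not parallel. The factor 2 is the sign of the multiple.
open Classical in
theorem card_attacking_pairs {M : Finset (ℤ × ℤ)} (hM : M ⊆ nightriderMoves) (hM1 : 1 ≤ M.card)
    (n : ℕ) : (Finset.univ.filter fun p : board n × board n => Attacks M p.1 p.2).card =
      n ^ 2 + M.card * (2 * halfLineCount n) := by
  rw [← Finset.card_filter_add_card_filter_not (p := fun p : board n × board n => p.1 = p.2)]
  congr 1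
  · rw [Finset.filter_filter, ← card_board, ← Fintype.card_coe (board n), ← Finset.card_univ]
    obtain ⟨m, hm⟩ := Finset.card_pos.1 hM1
    refine Finset.card_bij (fun p _ => p.1) (by simp) ?_ ?_
    · rintro ⟨z, w⟩ h ⟨z', w'⟩ h' hz
      obtain rfl : z = w := (Finset.mem_filter.1 h).2.2
      obtain rfl : z' = w' := (Finset.mem_filter.1 h').2.2
      obtain rfl : z = z' := hz
      rfl
    · intro z _
      exact ⟨(z, z), Finset.mem_filter.2 ⟨Finset.mem_univ _, ⟨m, hm, 0, by simp⟩, rfl⟩, rfl⟩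
  · let S : Finset ((ℤ × ℤ) × (ℕ × Bool)) := M ×ˢ (Finset.range n ×ˢ Finset.univ)
    have h1 : (S.sigma fun s => (board n).filter fun z => z + signedStep s.2 • s.1 ∈ board n).card =
        M.card * (2 * halfLineCount n) := by
      rw [Finset.card_sigma, Finset.sum_product, ← smul_eq_mul, ← Finset.sum_const]
      refine Finset.sum_congr rfl fun m hm => ?_
      rw [Finset.sum_product, halfLineCount, Finset.mul_sum]
      refine Finset.sum_congr rfl fun j _ => ?_
      have hb : ∀ b ∈ (Finset.univ : Finset Bool),
          ((board n).filter fun z => z + signedStep (j, b) • m ∈ board n).card =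
            (n - (j + 1)) * (n - 2 * (j + 1)) := fun b _ =>
        card_filter_add_smul_mem_board n (j + 1) (hM hm) (by cases b <;> simp [signedStep] <;> omega)
      rw [Finset.sum_congr rfl hb]
      simp
    rw [← h1]
    symm
    refine Finset.card_bij (fun t ht => (⟨t.2, ?_⟩, ⟨t.2 + signedStep t.1.2 • t.1.1, ?_⟩)) ?_ ?_ ?_
    · exact (Finset.mem_filter.1 (Finset.mem_sigma.1 ht).2).1
    · exact (Finset.mem_filter.1 (Finset.mem_sigma.1 ht).2).2
    · rintro ⟨⟨m, s⟩, z⟩ ht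
      have hm : m ∈ M := (Finset.mem_product.1 (Finset.mem_sigma.1 ht).1).1
      simp only [Finset.mem_filter, Finset.mem_univ, true_and, Subtype.mk.injEq]
      refine ⟨⟨m, hm, signedStep s, by simp⟩, fun h => ?_⟩
      have h0 : signedStep s • m = 0 := by simpa using h.symm
      have hne : signedStep s ≠ 0 := by
        rcases s with ⟨j, b⟩
        cases b <;> simp [signedStep] <;> omega
      have := (eq_of_smul_eq_smul (hM hm) (hM hm) hne (h0.trans (zero_smul ℤ m).symm)).2
      exact hne this
    · rintro ⟨⟨m, s⟩, z⟩ ht ⟨⟨m', s'⟩, z'⟩ ht' h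
      have hm : m ∈ M := (Finset.mem_product.1 (Finset.mem_sigma.1 ht).1).1
      have hm' : m' ∈ M := (Finset.mem_product.1 (Finset.mem_sigma.1 ht').1).1
      simp only [Prod.mk.injEq, Subtype.mk.injEq] at h
      obtain ⟨rfl, h⟩ := h
      have hne : signedStep s ≠ 0 := by
        rcases s with ⟨j, b⟩
        cases b <;> simp [signedStep] <;> omega
      obtain ⟨rfl, hs⟩ := eq_of_smul_eq_smul (hM hm) (hM hm') hne (add_left_cancel h)
      rw [signedStep_injective hs]
    · rintro ⟨z, w⟩ h
      simp only [Finset.mem_filter, Finset.mem_univ, true_and] at h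
      obtain ⟨⟨m, hm, r, hr⟩, hne⟩ := h
      have hr0 : r ≠ 0 := by
        rintro rfl
        rw [zero_smul, sub_eq_zero] at hr
        exact hne (Subtype.ext hr.symm)
      obtain ⟨s, hs, hs1⟩ := exists_signedStep_eq hr0
      have hw : (z : ℤ × ℤ) + r • m = w := by rw [← hr]; abel
      refine ⟨⟨(m, s), z⟩, ?_, ?_⟩
      · refine Finset.mem_sigma.2 ⟨Finset.mem_product.2 ⟨hm, Finset.mem_product.2
          ⟨Finset.mem_range.2 ?_, Finset.mem_univ _⟩⟩, Finset.mem_filter.2 ⟨z.2, ?_⟩⟩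
        · have hz' := mem_board.1 z.2
          have hw' := mem_board.1 w.2
          have h1 := congrArg Prod.fst hr
          have hm' := hM hm
          simp only [nightriderMoves, Finset.mem_insert, Finset.mem_singleton] at hm'
          simp only [Prod.fst_sub, Prod.smul_fst, smul_eq_mul] at h1
          rcases hm' with rfl | rfl | rfl | rfl <;> simp only at h1 ⊢ <;> omega
        · simp only [hs, hw]
          exact w.2
      · simp only [hs, hw]

theorem sum_range_mul_eq (x : ℚ) (h : ℕ) :
    ∑ j ∈ Finset.range h, (x - (j + 1)) * (x - 2 * (j + 1)) =
      h * x ^ 2 - 3 * x * (h * (h + 1)) / 2 + h * (h + 1) * (2 * h + 1) / 3 := by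
  induction h with
  | zero => simp
  | succ h ih =>
    rw [Finset.sum_range_succ, ih]
    push_cast
    ring

theorem halfLineCount_eq (n : ℕ) : (halfLineCount n : ℚ) =
    ∑ j ∈ Finset.range (n / 2), ((n : ℚ) - (j + 1)) * ((n : ℚ) - 2 * (j + 1)) := by
  have h : halfLineCount n = ∑ j ∈ Finset.range (n / 2), (n - (j + 1)) * (n - 2 * (j + 1)) := by
    rw [halfLineCount]
    refine (Finset.sum_subset (fun j hj => ?_) fun j _ hj => ?_).symm
    · simp only [Finset.mem_range] at hj ⊢
      omega
    · simp only [Finset.mem_range] at hj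
      have : n - 2 * (j + 1) = 0 := by omega
      rw [this, mul_zero]
  rw [h]
  push_cast
  refine Finset.sum_congr rfl fun j hj => ?_
  simp only [Finset.mem_range] at hj
  rw [Nat.cast_sub (by omega), Nat.cast_sub (by omega)]
  push_cast
  ring

/-- The constant is the integral of (1 - t)(1 - 2t) over 0 ≤ t ≤ 1/2, namely 5/24. -/
theorem abs_halfLineCount_sub_le (n : ℕ) :
    |(halfLineCount n : ℚ) - 5 / 24 * (n : ℚ) ^ 3| ≤ (n : ℚ) ^ 2 := by
  rw [halfLineCount_eq, sum_range_mul_eq]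
  rcases Nat.even_or_odd' n with ⟨h, rfl | rfl⟩
  · rw [show 2 * h / 2 = h by omega]
    push_cast
    rcases Nat.eq_zero_or_pos h with rfl | hh
    · simp
    · have h1 : (1 : ℚ) ≤ h := by exact_mod_cast hh
      rw [abs_le]
      constructor <;> nlinarith
  · rw [show (2 * h + 1) / 2 = h by omega]
    push_cast
    have h1 : (0 : ℚ) ≤ h := by positivity
    rw [abs_le]
    constructor <;> nlinarith

open Classical in
theorem abs_card_attacking_pairs_sub_le {M : Finset (ℤ × ℤ)} (hM : M ⊆ nightriderMoves)
    (hM1 : 1 ≤ M.card) (n : ℕ) :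
    |((Finset.univ.filter fun p : board n × board n => Attacks M p.1 p.2).card : ℚ) -
      5 * M.card / 12 * (n : ℚ) ^ 3| ≤ (1 + 2 * M.card) * (n : ℚ) ^ 2 := by
  rw [card_attacking_pairs hM hM1]
  push_cast
  have h := abs_le.1 (abs_halfLineCount_sub_le n)
  have hk : (0 : ℚ) ≤ M.card := by positivity
  have hn : (0 : ℚ) ≤ (n : ℚ) ^ 2 := by positivity
  rw [abs_le]
  constructor <;> nlinarith [mul_le_mul_of_nonneg_left h.1 hk, mul_le_mul_of_nonneg_left h.2 hk]

theorem labelledCount_le (M : Finset (ℤ × ℤ)) (q n : ℕ) : labelledCount M q n ≤ n ^ (2 * q) := by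
  classical
  refine (Finset.card_filter_le _ _).trans_eq ?_
  rw [Fintype.card_piFinset, Finset.prod_const, card_board, ← pow_mul]
  simp

/-- The multiple r = 0 makes pieces on one square attack each other, so nonattacking labelled
placements are injective and each image set has q! labellings. -/
theorem labelledCount_eq_factorial_mul {M : Finset (ℤ × ℤ)} (hM1 : 1 ≤ M.card) (q n : ℕ) :
    labelledCount M q n = q ! * unlabelledCount M q n := by
  classical
  obtain ⟨m, hm⟩ := Finset.card_pos.1 hM1
  have hself : ∀ z, Attacks M z z := fun z => ⟨m, hm, 0, by simp⟩
  have hinj : ∀ z : Fin q → ℤ × ℤ, (∀ a b, a ≠ b → ¬ Attacks M (z a) (z b)) →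
      Function.Injective z := fun z hz a b hab => by
    by_contra h
    exact hz a b h (hab ▸ hself _)
  rw [labelledCount, unlabelledCount, mul_comm]
  rw [Finset.card_eq_sum_card_fiberwise (f := fun z => Finset.univ.image z)
    (t := ((board n).powersetCard q).filter
      fun S => ∀ z ∈ S, ∀ w ∈ S, z ≠ w → ¬ Attacks M z w)]
  · refine (Finset.sum_congr rfl (g := fun _ => q !) fun S hS => ?_).trans (by
      rw [Finset.sum_const, smul_eq_mul]
      congr!)
    obtain ⟨hS1, hS2⟩ := Finset.mem_filter.1 hS
    obtain ⟨hS3, hS4⟩ := Finset.mem_powersetCard.1 hS1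
    have hcard : (Finset.univ : Finset (Fin q ≃ S)).card = q ! := by
      rw [Finset.card_univ, Fintype.card_equiv (S.equivFinOfCardEq hS4).symm, Fintype.card_fin]
    rw [← hcard]
    symm
    refine Finset.card_bij (fun e _ a => (e a : ℤ × ℤ)) ?_ ?_ ?_
    · intro e _
      refine Finset.mem_filter.2 ⟨Finset.mem_filter.2 ⟨Fintype.mem_piFinset.2 fun a =>
        hS3 (e a).2, fun a b hab => hS2 _ (e a).2 _ (e b).2 fun h => hab
          (e.injective (Subtype.ext h))⟩, ?_⟩
      ext x
      simp only [Finset.mem_image, Finset.mem_univ, true_and]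
      exact ⟨by rintro ⟨a, rfl⟩; exact (e a).2, fun hx => ⟨e.symm ⟨x, hx⟩, by simp⟩⟩
    · intro e _ e' _ h
      exact Equiv.ext fun a => Subtype.ext (congrFun h a)
    · intro z hz
      obtain ⟨hz1, rfl⟩ := Finset.mem_filter.1 hz
      have hzinj := hinj z (Finset.mem_filter.1 hz1).2
      refine ⟨Equiv.ofBijective (fun a => ⟨z a, Finset.mem_image_of_mem z (Finset.mem_univ a)⟩)
        ⟨fun a b h => hzinj (congrArg Subtype.val h), fun x => ?_⟩, Finset.mem_univ _, rfl⟩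
      obtain ⟨a, -, ha⟩ := Finset.mem_image.1 x.2
      exact ⟨a, Subtype.ext ha⟩
  · intro z hz
    obtain ⟨hz1, hz2⟩ := Finset.mem_filter.1 hz
    refine Finset.mem_coe.2 (Finset.mem_filter.2 ⟨Finset.mem_powersetCard.2 ⟨?_, ?_⟩, ?_⟩)
    · intro x hx
      obtain ⟨a, -, rfl⟩ := Finset.mem_image.1 hx
      exact Fintype.mem_piFinset.1 hz1 a
    · rw [Finset.card_image_of_injective _ (hinj z hz2), Finset.card_univ, Fintype.card_fin]
    · intro x hx y hy hxy
      obtain ⟨a, -, rfl⟩ := Finset.mem_image.1 hx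
      obtain ⟨b, -, rfl⟩ := Finset.mem_image.1 hy
      exact hz2 a b fun h => hxy (congrArg z h)

/-! ### Binomial inversion and extraction of coefficients. -/

theorem eq_sum_choose_of_binomial_transform {A : Type*} [CommRing A] (x : A) (o : ℕ → A) (q : ℕ) :
    o q = ∑ κ ∈ Finset.range (q + 1), (q.choose κ : A) * x ^ (q - κ) *
      ∑ j ∈ Finset.range (κ + 1), (κ.choose j : A) * (-x) ^ (κ - j) * o j := by
  -- Umbral argument: the functional X^j ↦ `o j` is applied to X^q = ((X - x) + x)^q.
  let L : A[X] →ₗ[A] A := Polynomial.lsum fun j => LinearMap.mulRight A (o j)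
  have hL : ∀ (c : A) j, L (Polynomial.C c * Polynomial.X ^ j) = c * o j := fun c j => by
    rw [Polynomial.C_mul_X_pow_eq_monomial, Polynomial.lsum_apply,
      Polynomial.sum_monomial_index _ _ (by simp)]
    simp
  have hpow : ∀ κ, L ((Polynomial.X + Polynomial.C (-x)) ^ κ) =
      ∑ j ∈ Finset.range (κ + 1), (κ.choose j : A) * (-x) ^ (κ - j) * o j := fun κ => by
    rw [add_pow, map_sum]
    refine Finset.sum_congr rfl fun j _ => ?_
    rw [← hL]
    congr 1
    simp only [Polynomial.C_mul, Polynomial.C_pow, ← Polynomial.C_eq_natCast]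
    ring
  have h : (Polynomial.X : A[X]) ^ q = ∑ κ ∈ Finset.range (q + 1),
      ((q.choose κ : A) * x ^ (q - κ)) • (Polynomial.X + Polynomial.C (-x)) ^ κ := by
    have := add_pow (Polynomial.X + Polynomial.C (-x)) (Polynomial.C x) q
    rw [show Polynomial.X + Polynomial.C (-x) + Polynomial.C x = Polynomial.X by
      rw [Polynomial.C_neg]; ring] at this
    rw [this]
    refine Finset.sum_congr rfl fun κ _ => ?_
    rw [Polynomial.smul_eq_C_mul]
    simp only [Polynomial.C_mul, Polynomial.C_pow, ← Polynomial.C_eq_natCast]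
    ring
  have h1 := hL 1 q
  rw [map_one, one_mul, one_mul, h, map_sum] at h1
  rw [← h1]
  refine Finset.sum_congr rfl fun κ _ => ?_
  rw [map_smul, hpow, smul_eq_mul]

theorem exists_abs_pow_sub_pow_le {c C : ℚ} (i : ℕ) : ∃ K : ℚ, ∀ (a : ℚ) (n : ℕ), 1 ≤ n →
    |a - c * (n : ℚ) ^ 3| ≤ C * (n : ℚ) ^ 2 →
      |a ^ i - c ^ i * (n : ℚ) ^ (3 * i)| * n ≤ K * (n : ℚ) ^ (3 * i) := by
  induction i with
  | zero => exact ⟨0, fun a n _ _ => by simp⟩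
  | succ i ih =>
    obtain ⟨K, hK⟩ := ih
    refine ⟨K * (|c| + C) + |c| ^ i * C, fun a n hn ha => ?_⟩
    have h1 := hK a n hn ha
    have hn1 : (1 : ℚ) ≤ n := by exact_mod_cast hn
    have hC : 0 ≤ C * (n : ℚ) ^ 2 := (abs_nonneg _).trans ha
    have ha' : |a| ≤ (|c| + C) * (n : ℚ) ^ 3 := by
      have h2 : |a| ≤ |a - c * (n : ℚ) ^ 3| + |c * (n : ℚ) ^ 3| := by
        have := abs_add_le (a - c * (n : ℚ) ^ 3) (c * (n : ℚ) ^ 3)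
        rwa [sub_add_cancel] at this
      rw [abs_mul, abs_of_nonneg (by positivity : (0 : ℚ) ≤ (n : ℚ) ^ 3)] at h2
      have h3 := mul_le_mul_of_nonneg_left hn1 hC
      have e : (|c| + C) * (n : ℚ) ^ 3 = |c| * (n : ℚ) ^ 3 + C * (n : ℚ) ^ 2 * n := by ring
      linarith
    have e : a ^ (i + 1) - c ^ (i + 1) * (n : ℚ) ^ (3 * (i + 1)) =
        (a ^ i - c ^ i * (n : ℚ) ^ (3 * i)) * a +
          c ^ i * (n : ℚ) ^ (3 * i) * (a - c * (n : ℚ) ^ 3) := by ring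
    rw [e]
    calc _ ≤ (|a ^ i - c ^ i * (n : ℚ) ^ (3 * i)| * |a| +
          |c| ^ i * (n : ℚ) ^ (3 * i) * |a - c * (n : ℚ) ^ 3|) * n := by
          gcongr
          refine (abs_add_le _ _).trans_eq ?_
          rw [abs_mul, abs_mul, abs_mul, abs_pow,
            abs_of_nonneg (by positivity : (0 : ℚ) ≤ (n : ℚ) ^ (3 * i))]
      _ = |a ^ i - c ^ i * (n : ℚ) ^ (3 * i)| * n * |a| +
          |c| ^ i * (n : ℚ) ^ (3 * i) * |a - c * (n : ℚ) ^ 3| * n := by ring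
      _ ≤ K * (n : ℚ) ^ (3 * i) * ((|c| + C) * (n : ℚ) ^ 3) +
          |c| ^ i * (n : ℚ) ^ (3 * i) * (C * (n : ℚ) ^ 2) * n := by
          gcongr
          exact (mul_nonneg (abs_nonneg _) (by positivity)).trans h1
      _ = _ := by ring

theorem IsQuasipolynomial.of_polynomials {f : ℕ → ℕ} {d p : ℕ} {Q : ℕ → ℚ[X]} {a : ℚ} (hp : 0 < p)
    (hQ : Function.Periodic Q p) (hdeg : ∀ n, (Q n).natDegree ≤ d)
    (h : ∀ n : ℕ, 1 ≤ n → a * (f n : ℚ) = (Q n).eval (n : ℚ)) (ha : a ≠ 0) :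
    IsQuasipolynomial f d fun i n => (Q n).coeff (d - i) / a := by
  refine ⟨⟨p, hp, fun i _ n => by simp only [hQ n]⟩, fun n hn => ?_⟩
  have h1 := h n hn
  rw [Polynomial.eval_eq_sum_range' (Nat.lt_succ_of_le (hdeg n)), ← Finset.sum_range_reflect] at h1
  have h2 : (f n : ℚ) = (a * f n) / a := by field_simp
  rw [h2, h1, Finset.sum_div]
  refine Finset.sum_congr rfl fun i _ => ?_
  rw [Nat.succ_sub_one]
  ring

/-- Uniqueness of the coefficients, needed because the final claim concerns every admissible `γ`. -/
theorem IsQuasipolynomial.coeff_eq {f : ℕ → ℕ} {d p : ℕ} {Q : ℕ → ℚ[X]} {a : ℚ}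
    {γ : ℕ → ℕ → ℚ} (hγ : IsQuasipolynomial f d γ) (hp : 0 < p) (hQ : Function.Periodic Q p)
    (h : ∀ n : ℕ, 1 ≤ n → a * (f n : ℚ) = (Q n).eval (n : ℚ)) {i : ℕ} (hi : i ≤ d) (n : ℕ) :
    a * γ i n = (Q n).coeff (d - i) := by
  obtain ⟨⟨p', hp', hper⟩, hf⟩ := hγ
  let Q' : ℕ → ℚ[X] := fun n => ∑ j ∈ Finset.range (d + 1),
    Polynomial.C (a * γ j n) * Polynomial.X ^ (d - j)
  have hQ' : Function.Periodic Q' p' := fun n => by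
    refine Finset.sum_congr rfl fun j hj => ?_
    rw [hper j (Nat.lt_succ_iff.1 (Finset.mem_range.1 hj)) n]
  have heq : Q = Q' := eq_of_eval_eq hp hQ hp' hQ' fun n hn => by
    rw [← h n hn, hf n hn, Polynomial.eval_finsetSum, Finset.mul_sum]
    refine Finset.sum_congr rfl fun j _ => ?_
    simp
    ring
  rw [heq, Polynomial.finsetSum_coeff, Finset.sum_eq_single i]
  · rw [Polynomial.coeff_C_mul_X_pow, if_pos rfl]
  · intro j hj hji
    rw [Polynomial.coeff_C_mul_X_pow, if_neg]
    simp only [Finset.mem_range] at hj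
    omega
  · intro h
    simp only [Finset.mem_range] at h
    omega

/-- The polynomial `x (x - 1) ⋯ (x - κ + 1) / κ!`. -/
noncomputable def choosePolynomial (κ : ℕ) : ℚ[X] :=
  Polynomial.C (1 / (κ ! : ℚ)) * descPochhammer ℚ κ

theorem choosePolynomial_eval (κ q : ℕ) : (choosePolynomial κ).eval (q : ℚ) = q.choose κ := by
  rw [choosePolynomial, Polynomial.eval_mul, Polynomial.eval_C,
    descPochhammer_eval_eq_descFactorial, Nat.descFactorial_eq_factorial_mul_choose]
  have : (κ ! : ℚ) ≠ 0 := by positivity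
  push_cast
  field_simp

theorem choosePolynomial_natDegree_le (κ : ℕ) : (choosePolynomial κ).natDegree ≤ κ :=
  (Polynomial.natDegree_C_mul_le _ _).trans (descPochhammer_natDegree ℚ κ).le

theorem choosePolynomial_coeff (κ : ℕ) : (choosePolynomial κ).coeff κ = 1 / (κ ! : ℚ) := by
  have h : (descPochhammer ℚ κ).coeff κ = 1 := by
    have := (monic_descPochhammer ℚ κ).coeff_natDegree
    rwa [descPochhammer_natDegree] at this
  rw [choosePolynomial, Polynomial.coeff_C_mul, h, mul_one]

end Rider

/-! ### The main theorem. -/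

theorem theoremT (M : Finset (ℤ × ℤ)) (k : ℕ) (hM : M ⊆ Rider.nightriderMoves)
    (hk : M.card = k) (hk1 : 1 ≤ k) :
    (∀ q : ℕ, 1 ≤ q → ∃ γ : ℕ → ℕ → ℚ,
      Rider.IsQuasipolynomial (Rider.unlabelledCount M q) (2 * q) γ ∧
      Rider.IsQuasipolynomial (Rider.labelledCount M q) (2 * q)
        (fun i n => (q ! : ℚ) * γ i n)) ∧
    (∀ i : ℕ, ∃ p : ℕ, 0 < p ∧ ∃ P : ℕ → ℚ[X],
      Function.Periodic P p ∧
      (∀ n : ℕ, (P n).natDegree = 2 * i ∧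
        (P n).leadingCoeff = (-(5 * (k : ℚ) / 24)) ^ i / (i ! : ℚ)) ∧
      ∀ q : ℕ, 1 ≤ q → i ≤ 2 * q → ∀ γ : ℕ → ℕ → ℚ,
        Rider.IsQuasipolynomial (Rider.unlabelledCount M q) (2 * q) γ →
        ∀ n : ℕ, (q ! : ℚ) * γ i n = (P n).eval (q : ℚ)) := by
  classical
  subst hk
  choose p hp Q hQ hQeval using fun q => Rider.exists_labelledCount_eq_eval hM q
  have hQdeg : ∀ q n, (Q q n).natDegree ≤ 2 * q := fun q =>
    Rider.natDegree_le_of_growth (hp q) (hQ q) (C := 1) fun n hn => by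
      rw [← hQeval q n hn, Nat.abs_cast, one_mul]
      exact_mod_cast Rider.labelledCount_le M q n
  have hfac : ∀ q : ℕ, (q ! : ℚ) ≠ 0 := fun q => by positivity
  have hu : ∀ q n : ℕ, 1 ≤ n →
      (q ! : ℚ) * (Rider.unlabelledCount M q n : ℚ) = (Q q n).eval (n : ℚ) := fun q n hn => by
    rw [← hQeval q n hn, Rider.labelledCount_eq_factorial_mul hk1]
    push_cast
    rfl
  refine ⟨fun q _ => ⟨_, Rider.IsQuasipolynomial.of_polynomials (hp q) (hQ q) (hQdeg q) (hu q)
    (hfac q), ?_⟩, fun i => ?_⟩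
  · have h := Rider.IsQuasipolynomial.of_polynomials (f := Rider.labelledCount M q) (a := 1) (hp q)
      (hQ q) (hQdeg q) (fun n hn => by rw [one_mul, hQeval q n hn]) one_ne_zero
    convert h using 3 with i n
    field_simp
  let F : ℕ → ℕ → ℚ[X] := fun κ n => ∑ j ∈ Finset.range (κ + 1),
    (κ.choose j : ℚ[X]) * (-(Polynomial.X ^ 2)) ^ (κ - j) * Q j n
  let pF : ℕ → ℕ := fun κ => ∏ j ∈ Finset.range (κ + 1), p j
  have hpF : ∀ κ, 0 < pF κ := fun κ => Finset.prod_pos fun j _ => hp j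
  have hper : ∀ κ j, j ≤ κ → ∀ c n, Q j (n + c * pF κ) = Q j n := fun κ j hj c n => by
    obtain ⟨d, hd⟩ := Finset.dvd_prod_of_mem p (Finset.mem_range.2 (Nat.lt_succ_of_le hj))
    rw [show c * pF κ = c * d * p j by rw [mul_assoc, mul_comm d]; exact congrArg _ hd]
    exact Rider.periodic_add_mul (hQ j) n (c * d)
  have hF : ∀ κ, Function.Periodic (F κ) (pF κ) := fun κ n => by
    refine Finset.sum_congr rfl fun j hj => ?_
    have := hper κ j (Nat.lt_succ_iff.1 (Finset.mem_range.1 hj)) 1 n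
    rw [one_mul] at this
    rw [this]
  let R : (n : ℕ) → Rider.board n → Rider.board n → Prop := fun n z w => Rider.Attacks M z w
  have hR : ∀ n, ∀ ⦃x y⦄, R n x y → R n y x := fun n x y h => Rider.Attacks.symm h
  have hT : ∀ n, Fintype.card (Rider.board n) = n ^ 2 := fun n => by
    rw [Fintype.card_coe, Rider.card_board]
  have hFeval : ∀ (ι : Type) [Fintype ι] [DecidableEq ι] (n : ℕ), 1 ≤ n →
      (F (Fintype.card ι) n).eval (n : ℚ) =
        ∑ z : ι → Rider.board n, Rider.signedIndependent (Rider.relationGraph (R n) (hR n) z) := by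
    intro ι _ _ n hn
    rw [← Rider.sum_choose_independentCount, Polynomial.eval_finsetSum]
    refine Finset.sum_congr rfl fun j _ => ?_
    rw [hT, ← Rider.labelledCount_eq_independentCount, hQeval j n hn]
    simp
  have hFdeg : ∀ κ n, (F κ n).natDegree ≤ κ + κ / 2 := fun κ => by
    obtain ⟨C, hC⟩ := Rider.exists_abs_sum_signedIndependent_le (Fin κ)
    refine Rider.natDegree_le_of_growth (hpF κ) (hF κ) (C := C) fun n hn => ?_
    have := hC (R n) (hR n) hn (hT n) (Rider.ncard_attacked_le hM hn)
    rw [← hFeval (Fin κ) n hn, Fintype.card_fin] at this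
    exact this
  have hFlead : ∀ n, (F (2 * i) n).coeff (3 * i) =
      (-1) ^ i * (Rider.matchings i).card * (5 * M.card / 12) ^ i := by
    obtain ⟨C, hC⟩ := Rider.exists_abs_sum_sub_le i
    obtain ⟨K, hK⟩ := Rider.exists_abs_pow_sub_pow_le (c := 5 * M.card / 12)
      (C := 1 + 2 * M.card) i
    refine Rider.coeff_eq_of_growth (hpF _) (hF _) (C := C + (Rider.matchings i).card * K)
      fun n hn => ?_
    have h1 := hC (R n) (hR n) hn (hT n) (Rider.ncard_attacked_le hM hn)
    have h2 := hK _ n hn (Rider.abs_card_attacking_pairs_sub_le hM hk1 n)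
    have hcard : Fintype.card (Fin i × Bool) = 2 * i := by simp [mul_comm]
    have h3 := hFeval (Fin i × Bool) n hn
    rw [hcard] at h3
    rw [← h3] at h1
    set a : ℚ := ((Finset.univ.filter fun p : Rider.board n × Rider.board n =>
      Rider.Attacks M p.1 p.2).card : ℚ) with ha
    set N : ℚ := ((Rider.matchings i).card : ℚ)
    have hN : 0 ≤ N := by positivity
    set E : ℚ := (F (2 * i) n).eval (n : ℚ)
    set c : ℚ := 5 * M.card / 12
    have e : E - (-1) ^ i * N * c ^ i * (n : ℚ) ^ (3 * i) = (E - (-1) ^ i * N * a ^ i) +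
        (-1) ^ i * N * (a ^ i - c ^ i * (n : ℚ) ^ (3 * i)) := by ring
    rw [e]
    calc _ ≤ (|E - (-1) ^ i * N * a ^ i| + N * |a ^ i - c ^ i * (n : ℚ) ^ (3 * i)|) * n := by
          gcongr
          refine (abs_add_le _ _).trans_eq ?_
          rw [abs_mul, abs_mul, abs_pow, abs_neg, abs_one, one_pow, one_mul, abs_of_nonneg hN]
      _ = |E - (-1) ^ i * N * a ^ i| * n + N * (|a ^ i - c ^ i * (n : ℚ) ^ (3 * i)| * n) := by ring
      _ ≤ C * (n : ℚ) ^ (3 * i) + N * (K * (n : ℚ) ^ (3 * i)) := by gcongr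
      _ = _ := by ring
  -- The case distinction discards the κ for which truncated subtraction would wrongly return the
  -- constant coefficient.
  let t : ℕ → ℕ → ℚ := fun κ n => if i ≤ 2 * κ then (F κ n).coeff (2 * κ - i) else 0
  let P : ℕ → ℚ[X] := fun n => ∑ κ ∈ Finset.range (2 * i + 1),
    Polynomial.C (t κ n) * Rider.choosePolynomial κ
  have ht : ∀ κ n, 2 * i < κ → t κ n = 0 := fun κ n hκ => by
    simp only [t]
    rw [if_pos (by omega)]
    refine Polynomial.coeff_eq_zero_of_natDegree_lt ((hFdeg κ n).trans_lt ?_)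
    omega
  have hPcoeff : ∀ n, (P n).coeff (2 * i) = (-(5 * (M.card : ℚ) / 24)) ^ i / (i ! : ℚ) := by
    intro n
    simp only [P]
    rw [Finset.sum_range_succ, Polynomial.coeff_add, Polynomial.finsetSum_coeff,
      Finset.sum_eq_zero, zero_add, Polynomial.coeff_C_mul, Rider.choosePolynomial_coeff]
    · simp only [t]
      rw [if_pos (by omega), show 2 * (2 * i) - i = 3 * i by omega, hFlead]
      have hcm : ((Rider.matchings i).card : ℚ) * (2 ^ i * (i ! : ℚ)) = ((2 * i)! : ℚ) := by
        exact_mod_cast Rider.card_matchings i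
      have h1 := hfac i
      have h2 := hfac (2 * i)
      have e : -(5 * (M.card : ℚ) / 24) = -1 * (5 * M.card / 12) * (1 / 2) := by ring
      rw [e, mul_pow, mul_pow, ← hcm, one_div_pow]
      have h3 : ((Rider.matchings i).card : ℚ) ≠ 0 := fun h => h2 (by rw [← hcm, h, zero_mul])
      field_simp
    · intro κ hκ
      rw [Polynomial.coeff_C_mul, Polynomial.coeff_eq_zero_of_natDegree_lt, mul_zero]
      exact (Rider.choosePolynomial_natDegree_le κ).trans_lt (Finset.mem_range.1 hκ)
  have hPdeg : ∀ n, (P n).natDegree = 2 * i := fun n => by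
    refine le_antisymm (Polynomial.natDegree_sum_le_of_forall_le _ _ fun κ hκ => ?_)
      (Polynomial.le_natDegree_of_ne_zero ?_)
    · refine (Polynomial.natDegree_C_mul_le _ _).trans
        ((Rider.choosePolynomial_natDegree_le κ).trans ?_)
      exact Nat.lt_succ_iff.1 (Finset.mem_range.1 hκ)
    · rw [hPcoeff]
      have hk0 : (0 : ℚ) < M.card := by exact_mod_cast hk1
      exact div_ne_zero (pow_ne_zero _ (by linarith)) (hfac i)
  -- Only the counts of at most 2i pieces enter `P`, so this period does not depend on q.
  refine ⟨pF (2 * i), hpF _, P, fun n => ?_, fun n => ⟨hPdeg n, ?_⟩, ?_⟩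
  · refine Finset.sum_congr rfl fun κ hκ => ?_
    have hFκ : F κ (n + pF (2 * i)) = F κ n := by
      refine Finset.sum_congr rfl fun j hj => ?_
      have := hper (2 * i) j (by
        have := Finset.mem_range.1 hj
        have := Finset.mem_range.1 hκ
        omega) 1 n
      rw [one_mul] at this
      rw [this]
    simp only [t, hFκ]
  · rw [Polynomial.leadingCoeff, hPdeg, hPcoeff]
  · intro q _ hiq γ hγ n
    rw [hγ.coeff_eq (hp q) (hQ q) (hu q) hiq n]
    have hinv : Q q n = ∑ κ ∈ Finset.range (q + 1),
        (q.choose κ : ℚ[X]) * (Polynomial.X ^ 2) ^ (q - κ) * F κ n :=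
      Rider.eq_sum_choose_of_binomial_transform (Polynomial.X ^ 2) (fun j => Q j n) q
    have h1 : (Q q n).coeff (2 * q - i) =
        ∑ κ ∈ Finset.range (q + 1), (q.choose κ : ℚ) * t κ n := by
      rw [hinv, Polynomial.finsetSum_coeff]
      refine Finset.sum_congr rfl fun κ hκ => ?_
      have hκq := Nat.lt_succ_iff.1 (Finset.mem_range.1 hκ)
      rw [mul_assoc, ← Polynomial.C_eq_natCast, Polynomial.coeff_C_mul, ← pow_mul,
        Polynomial.coeff_X_pow_mul']
      congr 1
      refine if_congr (by omega) ?_ rfl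
      congr 1
      omega
    have h2 : (P n).eval (q : ℚ) =
        ∑ κ ∈ Finset.range (2 * i + 1), (q.choose κ : ℚ) * t κ n := by
      simp only [P]
      rw [Polynomial.eval_finsetSum]
      refine Finset.sum_congr rfl fun κ _ => ?_
      rw [Polynomial.eval_mul, Polynomial.eval_C, Rider.choosePolynomial_eval, mul_comm]
    rw [h1, h2]
    -- Both sums extend to a common range: the binomial coefficient vanishes for κ > q, and `t`
    -- vanishes for κ > 2i.
    trans ∑ κ ∈ Finset.range (q + 2 * i + 1), (q.choose κ : ℚ) * t κ n
    · refine Finset.sum_subset (fun κ hκ => ?_) fun κ _ hκ => ?_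
      · simp only [Finset.mem_range] at hκ ⊢
        omega
      · simp only [Finset.mem_range, not_lt] at hκ
        rw [Nat.choose_eq_zero_of_lt (by omega), Nat.cast_zero, zero_mul]
    · refine (Finset.sum_subset (fun κ hκ => ?_) fun κ _ hκ => ?_).symm
      · simp only [Finset.mem_range] at hκ ⊢
        omega
      · simp only [Finset.mem_range, not_lt] at hκ
        rw [ht κ n (by omega), mul_zero]
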